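/- **Setting.** Let $\mathcal S,\mathcal A$ be finite sets and consider a Markov decision process with discount factor $\gamma\in[0,1)$, transition probabilities $P(\cdot\mid s,a)$ and, independently of the transition, random rewards with law $R(s,a)$ supported in $[R_{\min},R_{\max}]$. Put $V_{\min}=R_{\min}/(1-\gamma)$, $V_{\max}=R_{\max}/(1-\gamma)$, and let $\mathcal Z$ be the set of families $Z=(Z(s,a))_{s,a}$ of probability distributions on $[V_{\min},V_{\max}]$; $F_\nu$ denotes the distribution function of a law $\nu$. Let $\pi$ be a fixed stationary policy and let $Z_\pi(s,a)$ be the law of the return $\sum_{t\ge0}\gamma^t r_t$ when starting with $s_0=s$, $a_0=a$ and following $\pi$ afterwards. For every $(s,a)$ let $n(s,a)\ge1$ be a fixed integer. Suppose that $n(s,a)$ independent samples from $R(s,a)$ and $n(s,a)$ independent samples from $P(\cdot\mid s,a)$ are given (no assumption is made on the dependence between the reward samples and the transition samples, or between samples of different state-action pairs), and let $\hat R(s,a)$, $\hat P(\cdot\mid s,a)$ be their empirical distributions. Define the empirical distributional Bellman operator by letting $\hat{\mathcal T}^\pi Z(s,a)$ be the law of $r+\gamma z$, where $r\sim\hat R(s,a)$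 is independent of $z\sim Z(s',a')$, $s'\sim\hat P(\cdot\mid s,a)$, $a'\sim\pi(\cdot\mid s')$. For $c\ge0$ the optimism operator $O_c:\mathcal Z\to\mathcal Z$ is given by $$F_{O_cZ(s,a)}(x)=\Big[F_{Z(s,a)}(x)-\tfrac{c}{\sqrt{n(s,a)}}\mathbf 1\{x\in[V_{\min},V_{\max})\}\Big]^+ .$$ For $\alpha\in(0,1]$ let $\operatorname{CVaR}_\alpha(\nu)=\sup_{t\in\mathbb R}\{t-\alpha^{-1}\mathbb E_{X\sim\nu}[(t-X)^+]\}$, and let $\bar\ell_2(Z,Z')=\max_{s,a}\big(\int(F_{Z(s,a)}(x)-F_{Z'(s,a)}(x))^2dx\big)^{1/2}$. **Theorem.** There is a universal constant $C>0$ such that for all such data, all $\delta\in(0,1)$ and all $$c\ \ge\ C\,\ln\big(\max\{2,\ |\mathcal S||\mathcal A|/\delta\}\big),$$ the following holds with probability at least $1-\delta$. The operator $O_c\hat{\mathcal T}^\pi$ has a unique fixed point $Z_\infty$ in $\mathcal Z$. For every $Z_0\in\mathcal Z$ the iterates $(O_c\hat{\mathcal T}^\pi)^mZ_0$ lie in $\mathcal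 Z$ and converge to $Z_\infty$ in $\bar\ell_2$ as $m\to\infty$, and $\operatorname{CVaR}_\alpha\big((O_c\hat{\mathcal T}^\pi)^mZ_0(s,a)\big)\to\operatorname{CVaR}_\alpha(Z_\infty(s,a))$ for all $(s,a)$ and all $\alpha\in(0,1]$. Moreover $$\operatorname{CVaR}_\alpha(Z_\infty(s,a))\ \ge\ \operatorname{CVaR}_\alpha(Z_\pi(s,a))\qquad\text{for all }(s,a)\text{ and all }\alpha\in(0,1].$$ -/

import Mathlib

open MeasureTheory ProbabilityTheory Set Filter Topology
open scoped ENNReal NNReal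

/-- A finite Markov decision process with random bounded rewards: on taking action `a` in state `s`
a reward with law `reward s a` is received and, independently of it, the next state has law
`trans s a`. -/
structure RewardMDP (S A : Type*) [MeasurableSpace S] where
  reward : S → A → ProbabilityMeasure ℝ
  trans : S → A → ProbabilityMeasure S
  discount : ℝ
  discount_nonneg : 0 ≤ discount
  discount_lt_one : discount < 1
  rmin : ℝ
  rmax : ℝ
  reward_mem : ∀ s a, ∀ᵐ r ∂(reward s a : Measure ℝ), r ∈ Icc rmin rmax

namespace RewardMDP

variable {S A : Type*} [MeasurableSpace S]

/-- The smallest possible return. -/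
noncomputable def vmin (M : RewardMDP S A) : ℝ := M.rmin / (1 - M.discount)

/-- The largest possible return. -/
noncomputable def vmax (M : RewardMDP S A) : ℝ := M.rmax / (1 - M.discount)

/-- The space of value distributions: families of probability distributions on `[vmin, vmax]`
indexed by state-action pairs. -/
def valueDists (M : RewardMDP S A) : Set (S → A → Measure ℝ) :=
  {Z | ∀ s a, IsProbabilityMeasure (Z s a) ∧ Z s a (Icc M.vmin M.vmax) = 1}

/-! ### The return of a policy -/

variable [MeasurableSpace A]

/-- Law of the triple (state, action, reward) when action `a` is taken in state `s`. -/
noncomputable def tripleLaw (M : RewardMDP S A) (s : S) (a : A) : Measure (S × A × ℝ) :=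
  (M.reward s a : Measure ℝ).map (fun r => (s, a, r))

/-- Law of the triple (state, action, reward) at the next time step, if the current state and
action are `s` and `a` and the next action is drawn from the policy `π`. -/
noncomputable def nextLaw [Fintype S] [Fintype A] (M : RewardMDP S A)
    (π : S → ProbabilityMeasure A) (s : S) (a : A) : Measure (S × A × ℝ) :=
  ∑ s' : S, ∑ a' : A,
    ((M.trans s a : Measure S) {s'} * (π s' : Measure A) {a'}) • M.tripleLaw s' a'

variable [Fintype S] [Fintype A] [MeasurableSingletonClass S] [MeasurableSingletonClass A]

/-- The transition kernel of the Markov chain of triples (state, action, reward): from `(s, a, r)`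
the next triple is drawn from `nextLaw π s a`. -/
noncomputable def stepKernel (M : RewardMDP S A) (π : S → ProbabilityMeasure A) :
    Kernel (S × A × ℝ) (S × A × ℝ) :=
  Kernel.comap (Kernel.ofFunOfCountable (fun p : S × A => M.nextLaw π p.1 p.2))
    (fun x : S × A × ℝ => (x.1, x.2.1)) (by fun_prop)

instance (M : RewardMDP S A) (s : S) (a : A) : IsProbabilityMeasure (M.tripleLaw s a) :=
  Measure.isProbabilityMeasure_map (by fun_prop)

instance (M : RewardMDP S A) (π : S → ProbabilityMeasure A) :
    IsMarkovKernel (M.stepKernel π) where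
  isProbabilityMeasure x := by
    constructor
    change M.nextLaw π x.1 x.2.1 univ = 1
    have hA : ∀ s', ∑ a' : A, (π s' : Measure A) {a'} = 1 := fun s' => by
      simp
    have hS : ∑ s' : S, (M.trans x.1 x.2.1 : Measure S) {s'} = 1 := by
      simp
    simp only [nextLaw, Measure.finsetSum_apply, Measure.smul_apply, measure_univ, smul_eq_mul,
      mul_one, ← Finset.mul_sum, hA, hS]

/-- Law of the infinite trajectory `(s₀, a₀, r₀), (s₁, a₁, r₁), …` of the policy `π` started with
`s₀ = s` and `a₀ = a`. -/
noncomputable def trajectoryLaw (M : RewardMDP S A) (π : S → ProbabilityMeasure A)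
    (s : S) (a : A) : Measure (ℕ → S × A × ℝ) :=
  Kernel.trajMeasure (X := fun _ : ℕ => S × A × ℝ) (M.tripleLaw s a)
    (fun n => (M.stepKernel π).comap (fun x => x ⟨n, Finset.mem_Iic.2 le_rfl⟩)
      (measurable_pi_apply _))

/-- The law of the return `∑ₜ γᵗ rₜ` of the policy `π` started with state `s` and action `a`. -/
noncomputable def returnLaw (M : RewardMDP S A) (π : S → ProbabilityMeasure A)
    (s : S) (a : A) : Measure ℝ :=
  (M.trajectoryLaw π s a).map (fun x => ∑' t : ℕ, M.discount ^ t * (x t).2.2)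

end RewardMDP

/-! ### Empirical model, Bellman operator, optimism operator -/

/-- The empirical distribution of a sample of size `n`. -/
noncomputable def empiricalMeasure {X : Type*} [MeasurableSpace X] {n : ℕ} (x : Fin n → X) :
    Measure X :=
  (n : ℝ≥0∞)⁻¹ • ∑ i, Measure.dirac (x i)

/-- The distributional Bellman operator with reward laws `R`, transition laws `P`, policy `π` and
discount factor `γ`: it sends `Z` to the law of `r + γ z` at `(s, a)`, where `r ∼ R s a` is
independent of `z ∼ Z s' a'`, `s' ∼ P s a`, `a' ∼ π s'`. -/
noncomputable def distBellman {S A : Type*} [Fintype S] [Fintype A] [MeasurableSpace S]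
    [MeasurableSpace A] (R : S → A → Measure ℝ) (P : S → A → Measure S)
    (π : S → ProbabilityMeasure A) (γ : ℝ) (Z : S → A → Measure ℝ) : S → A → Measure ℝ :=
  fun s a =>
    ((R s a).prod (∑ s' : S, ∑ a' : A, (P s a {s'} * (π s' : Measure A) {a'}) • Z s' a')).map
      (fun p : ℝ × ℝ => p.1 + γ * p.2)

/-- The function equal to `max (F x - k) 0` for `x < b` and to `1` for `b ≤ x`, where `F` is the
distribution function of `ν`. -/
noncomputable def shiftedCDF (b : ℝ) (k : ℝ≥0) (ν : Measure ℝ) : StieltjesFunction ℝ where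
  toFun x := if x < b then max (cdf ν x - k) 0 else 1
  mono' := by
    intro x y hxy
    have h1 := cdf_le_one ν x
    have h2 := monotone_cdf ν hxy
    have h3 : (0 : ℝ) ≤ k := k.2
    dsimp only
    split_ifs with hx hy hy
    · exact max_le_max (by linarith) le_rfl
    · exact max_le (by linarith) zero_le_one
    · exact absurd (hxy.trans_lt hy) hx
    · exact le_rfl
  right_continuous' := by
    intro x
    by_cases hx : x < b
    · have h : ContinuousWithinAt (fun y => max (cdf ν y - k) 0) (Ici x) x :=
        (((cdf ν).right_continuous x).sub continuousWithinAt_const).max continuousWithinAt_const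
      refine h.congr_of_eventuallyEq ?_ (by simp [hx])
      filter_upwards [mem_nhdsWithin_of_mem_nhds (Iio_mem_nhds hx)] with y hy
      exact if_pos hy
    · have h : ContinuousWithinAt (fun _ : ℝ => (1 : ℝ)) (Ici x) x := continuousWithinAt_const
      exact h.congr (fun y hy => if_neg (fun h' => hx (lt_of_le_of_lt hy h'))) (if_neg hx)

/-- The law obtained from a law `ν` on an interval `[a, b]` by lowering its distribution function
`F` by `k` on `[a, b)`, with truncation at `0`; see `cdf_optimisticLaw`. -/
noncomputable def optimisticLaw (b : ℝ) (k : ℝ≥0) (ν : Measure ℝ) : Measure ℝ :=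
  (shiftedCDF b k ν).measure

theorem cdf_optimisticLaw (a b : ℝ) (k : ℝ≥0) (ν : Measure ℝ) [IsProbabilityMeasure ν]
    (hν : ν (Icc a b) = 1) (x : ℝ) :
    cdf (optimisticLaw b k ν) x = max (cdf ν x - (Ico a b).indicator (fun _ => (k : ℝ)) x) 0 := by
  have hbot : Tendsto (shiftedCDF b k ν) atBot (𝓝 0) := by
    have h : Tendsto (fun y => max (cdf ν y - k) 0) atBot (𝓝 (max (0 - (k : ℝ)) 0)) :=
      ((tendsto_cdf_atBot ν).sub_const _).max tendsto_const_nhds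
    rw [max_eq_right (by simp)] at h
    refine h.congr' ?_
    filter_upwards [Iio_mem_atBot b] with y hy
    exact (if_pos hy).symm
  have htop : Tendsto (shiftedCDF b k ν) atTop (𝓝 1) := by
    refine tendsto_const_nhds.congr' ?_
    filter_upwards [Ici_mem_atTop b] with y hy
    exact (if_neg (not_lt.2 hy)).symm
  have hc : ν (Icc a b)ᶜ = 0 := (prob_compl_eq_zero_iff measurableSet_Icc).2 hν
  rw [optimisticLaw, cdf_measure_stieltjesFunction _ hbot htop]
  change (if x < b then max (cdf ν x - k) 0 else 1) = _
  by_cases hb : x < b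
  · rw [if_pos hb]
    by_cases ha : a ≤ x
    · rw [indicator_of_mem (show x ∈ Ico a b from ⟨ha, hb⟩)]
    · have h0 : cdf ν x = 0 := by
        rw [cdf_eq_real, measureReal_def, measure_mono_null _ hc, ENNReal.toReal_zero]
        intro y hy h
        exact ha (h.1.trans hy)
      rw [indicator_of_notMem (fun h => ha h.1), h0]
      simp
  · rw [if_neg hb, indicator_of_notMem (fun h => hb h.2)]
    have h1 : cdf ν x = 1 := by
      rw [cdf_eq_real, measureReal_def]
      have : ν (Iic x) = 1 :=
        le_antisymm prob_le_one (hν ▸ measure_mono (fun y hy => hy.2.trans (not_lt.1 hb)))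
      rw [this, ENNReal.toReal_one]
    rw [h1]
    simp

/-- The optimism operator with shift parameter `c` and visit counts `n`: the distribution function
at `(s, a)` is lowered by `c / √n(s,a)`. -/
noncomputable def optimism {S A : Type*} (b : ℝ) (n : S → A → ℕ) (c : ℝ≥0)
    (Z : S → A → Measure ℝ) : S → A → Measure ℝ :=
  fun s a => optimisticLaw b (c / NNReal.sqrt (n s a)) (Z s a)

/-! ### Conditional value at risk, Cramér distance -/

/-- The conditional value at risk `sup_t (t - α⁻¹ 𝔼[(t - X)⁺])` of `X ∼ ν` at level `α`. -/
noncomputable def cvar (α : ℝ) (ν : Measure ℝ) : ℝ :=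
  ⨆ t : ℝ, (t - α⁻¹ * ∫ x, max (t - x) 0 ∂ν)

/-- The maximal Cramér distance: the largest, over state-action pairs, `L²` distance of
distribution functions. -/
noncomputable def cramerDist {S A : Type*} (Z Z' : S → A → Measure ℝ) : ℝ :=
  ⨆ p : S × A, Real.sqrt (∫ x, (cdf (Z p.1 p.2) x - cdf (Z' p.1 p.2) x) ^ 2)

/-! Deterministic part. For fixed samples with rewards in the allowed range, the operator `U`, the
optimism shift after the empirical Bellman operator, is monotone for the pointwise order of
distribution functions and contracts their `L¹` distance by `γ`: mixing does not increase this
distance, `z ↦ r + γ z` multiplies it by `γ`, and `y ↦ (y - k)⁺` is 1-Lipschitz. This gives a unique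
fixed point that attracts all iterates. `L¹` convergence controls the Cramér distance, since the
differences are at most `1`, and it controls CVaR through the layer-cake formula `𝔼 (t - X)⁺ = ∫₀^∞
F (t - u) du`.

Optimism. It is enough that `U` does not raise the distribution functions of the law of the return
`Z_π`. The iterates of `U` from `Z_π` then have decreasing distribution functions, so none of them
has a smaller CVaR than `Z_π`, and neither has the limit. By the Bellman equation
`RewardMDP.bellman_returnLaw`, what is needed is a one-sided bound `c / √n` on the error of the
empirical Bellman operator at the single deterministic family `Z_π`. Half of it is spent on
replacing the reward law and half on replacing the transition law. Given the next state, the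
distribution function of `r + γ z` is monotone with values in `[0, 1]`. The transition error is thus
a uniform deviation of an empirical mean of i.i.d. random monotone functions, of the same kind as
for empirical distribution functions, with no cost depending on the number of states. Only the union
bound over state-action pairs costs a logarithm.

Concentration (`measure_exists_deviation_le`). An independent copy of the sample and random signs `ε
i` reduce the problem to exponential moments of `max_x l ∑ ε i * a i x`. Writing `a i x` as the
integral of `1 {u < a i x}` over `u ∈ [0, 1)` and using Jensen reduces monotone functions to
indicators. As `x` grows the indicators switch on one after another, so the sum is a random walk
observed at some time, and Doob's `L²` maximal inequality costs only a factor `4`. -/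

/-! ### A maximal inequality for random signs -/

/-- The sign `1` on a set `J` and `-1` off it. -/
def signOf {ι : Type*} [DecidableEq ι] (J : Finset ι) (i : ι) : ℝ := if i ∈ J then 1 else -1

theorem abs_signOf {ι : Type*} [DecidableEq ι] (J : Finset ι) (i : ι) : |signOf J i| = 1 := by
  unfold signOf; split_ifs <;> simp

theorem sum_signOf_insert_of_le {ι : Type*} [DecidableEq ι] {a : ι} {I J : Finset ι}
    (ha : a ∉ I) (κ : ι → ℕ) (t : ℕ) (hat : κ a ≤ t) :
    ∑ i ∈ insert a I with κ i ≤ t, signOf J i = signOf J a + ∑ i ∈ I with κ i ≤ t, signOf J i := by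
  rw [Finset.filter_insert, if_pos hat, Finset.sum_insert (by simp [ha])]

theorem sum_signOf_insert_right {ι : Type*} [DecidableEq ι] {a : ι} {I J : Finset ι}
    (ha : a ∉ I) (κ : ι → ℕ) (t : ℕ) :
    ∑ i ∈ I with κ i ≤ t, signOf (insert a J) i = ∑ i ∈ I with κ i ≤ t, signOf J i := by
  refine Finset.sum_congr rfl fun i hi => ?_
  have : i ≠ a := fun h => ha (h ▸ (Finset.mem_filter.1 hi).1)
  simp [signOf, this]

/-- Doob's maximal inequality in `L²` for the exponential of a sum of random signs, started at a
value `x` with running maximum `m`. -/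
theorem sum_powerset_max_sq_le {ι : Type*} [DecidableEq ι] (κ : ι → ℕ) (l : ℝ) (I : Finset ι) :
    ∀ (x m : ℝ), 0 ≤ x → x ≤ m → ∀ θ : Finset ι → ℕ,
      ∑ J ∈ I.powerset, (max m (x * Real.exp (l * ∑ i ∈ I with κ i ≤ θ J, signOf J i))) ^ 2 ≤
        4 * x ^ 2 * (2 * Real.cosh (2 * l)) ^ I.card + 2 ^ I.card * (2 * m ^ 2 - 4 * m * x) := by
  induction I using Finset.induction_on_min_value κ with
  | empty =>
    intro x m hx hxm θ
    simp only [Finset.powerset_empty, Finset.filter_empty, Finset.sum_empty, mul_zero,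
      Real.exp_zero, mul_one, Finset.sum_singleton, Finset.card_empty, pow_zero, one_mul,
      max_eq_left hxm]
    -- The right-hand side exceeds the left-hand side by exactly `(2 * x - m) ^ 2`.
    nlinarith [sq_nonneg (2 * x - m)]
  | insert a I ha hmin ih =>
    intro x m hx hxm θ
    -- The element with the smallest `κ` is the first step of the walk. After it the walk restarts
    -- from `x * exp (±l)` with an updated running maximum, and the bound serves as a potential in
    -- `(x, m)`. Since `θ` is arbitrary, the induction hypothesis applies to each of the two signs
    -- with its own selection.
    rw [Finset.sum_powerset_insert ha, Finset.card_insert_of_notMem ha]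
    have key : ∀ (x' e : ℝ) (θ' : Finset ι → ℕ) (J : Finset ι), x' = x * Real.exp (l * e) →
        max m (x * Real.exp (l * (if κ a ≤ θ' J then e + ∑ i ∈ I with κ i ≤ θ' J, signOf J i
          else 0))) ^ 2 ≤
        (max (max m x') (x' * Real.exp (l * ∑ i ∈ I with κ i ≤ θ' J, signOf J i))) ^ 2 := by
      intro x' e θ' J hx'
      have h0 : 0 ≤ m := hx.trans hxm
      refine pow_le_pow_left₀ (le_max_of_le_left h0) ?_ 2
      split_ifs with h
      · rw [hx', mul_add, Real.exp_add, ← mul_assoc]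
        exact max_le (le_max_of_le_left (le_max_left _ _)) (le_max_right _ _)
      -- Stopping before the first step leaves the value `x`, which is at most `m`.
      · simp only [mul_zero, Real.exp_zero, mul_one]
        exact max_le (le_max_of_le_left (le_max_left _ _))
          (hxm.trans (le_max_of_le_left (le_max_left _ _)))
    have hsum : ∀ (J : Finset ι) (t : ℕ), ∑ i ∈ insert a I with κ i ≤ t, signOf J i =
        if κ a ≤ t then signOf J a + ∑ i ∈ I with κ i ≤ t, signOf J i else 0 := by
      intro J t
      split_ifs with h
      · exact sum_signOf_insert_of_le ha κ t h
      · rw [Finset.filter_insert, if_neg h]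
        refine Finset.sum_eq_zero fun i hi => ?_
        have h1 := hmin i (Finset.mem_filter.1 hi).1
        have h2 := (Finset.mem_filter.1 hi).2
        omega
    have hminus : ∑ J ∈ I.powerset,
        (max m (x * Real.exp (l * ∑ i ∈ insert a I with κ i ≤ θ J, signOf J i))) ^ 2 ≤
        4 * (x * Real.exp (l * -1)) ^ 2 * (2 * Real.cosh (2 * l)) ^ I.card + 2 ^ I.card *
          (2 * (max m (x * Real.exp (l * -1))) ^ 2 -
            4 * (max m (x * Real.exp (l * -1))) * (x * Real.exp (l * -1))) := by
      refine le_trans (Finset.sum_le_sum fun J hJ => ?_)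
        (ih (x * Real.exp (l * -1)) _ (by positivity) (le_max_right _ _) θ)
      have haJ : a ∉ J := fun h => ha (Finset.mem_powerset.1 hJ h)
      rw [hsum, show signOf J a = -1 by simp [signOf, haJ]]
      exact key _ (-1) θ J rfl
    have hplus : ∑ J ∈ I.powerset, (max m (x * Real.exp (l * ∑ i ∈ insert a I with
          κ i ≤ θ (insert a J), signOf (insert a J) i))) ^ 2 ≤
        4 * (x * Real.exp (l * 1)) ^ 2 * (2 * Real.cosh (2 * l)) ^ I.card + 2 ^ I.card *
          (2 * (max m (x * Real.exp (l * 1))) ^ 2 -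
            4 * (max m (x * Real.exp (l * 1))) * (x * Real.exp (l * 1))) := by
      refine le_trans (Finset.sum_le_sum fun J hJ => ?_)
        (ih (x * Real.exp (l * 1)) _ (by positivity) (le_max_right _ _)
          (fun J => θ (insert a J)))
      rw [hsum, sum_signOf_insert_right ha, show signOf (insert a J) a = 1 by simp [signOf]]
      exact key _ 1 (fun J => θ (insert a J)) J rfl
    -- Raising the running maximum to a new record `y` does not increase the potential: the gain is
    -- `2 * (y - m) ^ 2`.
    have hpot : ∀ y : ℝ, 2 * (max m y) ^ 2 - 4 * max m y * y ≤ 2 * m ^ 2 - 4 * m * y := by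
      intro y
      rcases le_total y m with h | h
      · rw [max_eq_left h]
      · rw [max_eq_right h]; nlinarith [sq_nonneg (y - m)]
    -- The submartingale property: averaged over the sign, the value does not decrease, so the term
    -- `-4 * m * x` only helps. The squares multiply exactly, as stated in `hc2`.
    have hcosh : Real.exp (l * 1) + Real.exp (l * -1) ≥ 2 := by
      have := Real.one_le_cosh l
      rw [Real.cosh_eq] at this
      rw [mul_one, mul_neg_one]; linarith
    have hc2 : Real.exp (l * 1) ^ 2 + Real.exp (l * -1) ^ 2 = 2 * Real.cosh (2 * l) := by
      rw [Real.cosh_eq, ← Real.exp_nat_mul, ← Real.exp_nat_mul]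
      push_cast
      ring_nf
    have hm : 0 ≤ m * x := mul_nonneg (hx.trans hxm) hx
    have h2 : (0 : ℝ) ≤ 2 ^ I.card := by positivity
    have e1 := mul_le_mul_of_nonneg_left (hpot (x * Real.exp (l * 1))) h2
    have e2 := mul_le_mul_of_nonneg_left (hpot (x * Real.exp (l * -1))) h2
    have e3 : (0:ℝ) ≤ 2 ^ I.card * (m * x * (Real.exp (l * 1) + Real.exp (l * -1) - 2)) := by
      have : 0 ≤ Real.exp (l * 1) + Real.exp (l * -1) - 2 := by linarith
      positivity
    rw [pow_succ _ I.card, pow_succ _ I.card, ← hc2]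
    rw [← hc2] at hminus hplus
    refine (add_le_add hminus hplus).trans ?_
    generalize (Real.exp (l * 1) ^ 2 + Real.exp (l * -1) ^ 2) ^ I.card = W at *
    linarith

/-- Exponential moments of the maximum of a random walk with random signs; the maximum is
expressed through an arbitrary selection of a stopping point. -/
theorem sum_powerset_exp_le {ι : Type*} [Fintype ι] [DecidableEq ι] (κ : ι → ℕ) (l : ℝ)
    (θ : Finset ι → ℕ) :
    ∑ J : Finset ι, Real.exp (l * ∑ i with κ i ≤ θ J, signOf J i) ≤
      4 * (2 * Real.cosh l) ^ Fintype.card ι := by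
  -- Halving `l` compensates the square. With `x = m = 1` the second term of the bound is negative
  -- and is dropped.
  have h := sum_powerset_max_sq_le κ (l / 2) Finset.univ 1 1 zero_le_one le_rfl θ
  rw [Finset.powerset_univ, show 2 * (l / 2) = l by ring, Finset.card_univ] at h
  have h2 : (0 : ℝ) ≤ 2 ^ Fintype.card ι := by positivity
  refine le_trans (Finset.sum_le_sum fun J _ => ?_) (h.trans (by linarith))
  set s := ∑ i with κ i ≤ θ J, signOf J i
  have e : Real.exp (l * s) = (1 * Real.exp (l / 2 * s)) ^ 2 := by
    rw [one_mul, ← Real.exp_nat_mul]; push_cast; ring_nf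
  rw [e]
  exact pow_le_pow_left₀ (by positivity) (le_max_right _ _) 2

/-- The maximal inequality for indicators of a chain of events. -/
theorem sum_exp_indicator_le {ι : Type*} [Fintype ι] [DecidableEq ι] (p : ι → ℝ → Prop)
    (hp : ∀ i x y, x ≤ y → p i x → p i y) [∀ i x, Decidable (p i x)] (l : ℝ)
    (T : Finset ℝ) (θ : Finset ι → ℝ) (hθ : ∀ J, θ J ∈ T) :
    ∑ J : Finset ι, Real.exp (l * ∑ i, signOf J i * (if p i (θ J) then 1 else 0)) ≤
      4 * (2 * Real.cosh l) ^ Fintype.card ι := by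
  -- The points of `T` at which `p i` fails form an initial segment of `T`. Its length is taken as
  -- `κ i`, the time at which `i` switches on. Since `θ J` itself lies in `T`, `p i (θ J)` holds
  -- exactly when `κ i` is at most the number of points of `T` below `θ J`.
  refine le_trans (le_of_eq (Finset.sum_congr rfl fun J _ => ?_))
    (sum_powerset_exp_le (fun i => (T.filter (fun x => ¬ p i x)).card) l
      (fun J => (T.filter (fun x => x < θ J)).card))
  congr 2
  simp only [mul_ite, mul_one, mul_zero]
  rw [← Finset.sum_filter]
  refine Finset.sum_congr (Finset.filter_congr fun i _ => ?_) fun _ _ => rfl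
  constructor
  · intro h
    refine Finset.card_le_card fun x hx => ?_
    rw [Finset.mem_filter] at hx ⊢
    refine ⟨hx.1, not_le.1 fun h' => hx.2 (hp i _ _ h' h)⟩
  · intro h
    by_contra hc
    refine absurd h (not_le.2 (Finset.card_lt_card ?_))
    refine (Finset.ssubset_iff_of_subset fun x hx => ?_).2
      ⟨θ J, Finset.mem_filter.2 ⟨hθ J, hc⟩, by simp⟩
    rw [Finset.mem_filter] at hx ⊢
    exact ⟨hx.1, fun h' => hc (hp i _ _ hx.2.le h')⟩

theorem integral_indicator_lt_unit {a : ℝ} (h0 : 0 ≤ a) (h1 : a ≤ 1) :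
    ∫ u in Ico (0 : ℝ) 1, (if u < a then (1 : ℝ) else 0) = a := by
  have : (fun u : ℝ => if u < a then (1 : ℝ) else 0) = (Iio a).indicator (fun _ => (1 : ℝ)) := by
    ext u; simp [indicator]
  rw [this, integral_indicator measurableSet_Iio, Measure.restrict_restrict measurableSet_Iio,
    integral_const]
  have : Iio a ∩ Ico (0 : ℝ) 1 = Ico 0 a := by
    ext u; simp only [mem_inter_iff, mem_Iio, mem_Ico]
    exact ⟨fun h => ⟨h.2.1, h.1⟩, fun h => ⟨h.2, h.1, h.2.trans_le h1⟩⟩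
  rw [this]
  simp [measureReal_def, h0]

/-- The maximal inequality for monotone functions with values in the unit interval. -/
theorem sum_exp_monotone_le {ι : Type*} [Fintype ι] [DecidableEq ι] (a : ι → ℝ → ℝ)
    (ha : ∀ i, Monotone (a i)) (h0 : ∀ i x, 0 ≤ a i x) (h1 : ∀ i x, a i x ≤ 1) (l : ℝ)
    (T : Finset ℝ) (θ : Finset ι → ℝ) (hθ : ∀ J, θ J ∈ T) :
    ∑ J : Finset ι, Real.exp (l * ∑ i, signOf J i * a i (θ J)) ≤
      4 * (2 * Real.cosh l) ^ Fintype.card ι := by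
  classical
  -- Layer cake: `a i x` is the mean of `1 {u < a i x}` for `u` uniform on `[0, 1)`. The selection
  -- `θ` does not depend on `u`, so after Jensen the indicator bound applies for each `u`.
  let P : Measure ℝ := volume.restrict (Ico (0 : ℝ) 1)
  have hP : IsProbabilityMeasure P := ⟨by simp [P]⟩
  let g : Finset ι → ℝ → ℝ := fun J u =>
    l * ∑ i, signOf J i * (if u < a i (θ J) then 1 else 0)
  have hmeas : ∀ J, Measurable (g J) := fun J => by
    refine Measurable.const_mul (Finset.measurable_sum _ fun i _ => Measurable.const_mul ?_ _) _
    exact Measurable.ite measurableSet_Iio measurable_const measurable_const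
  have hbd : ∀ J u, |g J u| ≤ |l| * Fintype.card ι := fun J u => by
    simp only [g, abs_mul]
    refine mul_le_mul_of_nonneg_left ((Finset.abs_sum_le_sum_abs _ _).trans ?_) (abs_nonneg _)
    calc ∑ i, |signOf J i * (if u < a i (θ J) then 1 else 0)| ≤ ∑ i : ι, (1 : ℝ) := by
          refine Finset.sum_le_sum fun i _ => ?_
          rw [abs_mul, abs_signOf]
          split_ifs <;> simp
      _ = _ := by simp
  have hint : ∀ J, Integrable (g J) P := fun J =>
    Integrable.of_bound (hmeas J).aestronglyMeasurable _ (.of_forall fun u => hbd J u)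
  have hinte : ∀ J, Integrable (fun u => Real.exp (g J u)) P := fun J =>
    Integrable.of_bound (hmeas J).exp.aestronglyMeasurable (Real.exp (|l| * Fintype.card ι))
      (.of_forall fun u => by
        rw [Real.norm_eq_abs, Real.abs_exp]
        exact Real.exp_le_exp.2 ((le_abs_self _).trans (hbd J u)))
  have hval : ∀ J, l * ∑ i, signOf J i * a i (θ J) = ∫ u, g J u ∂P := fun J => by
    rw [integral_const_mul, integral_finsetSum]
    · congr 1
      refine Finset.sum_congr rfl fun i _ => ?_
      rw [integral_const_mul]
      rw [integral_indicator_lt_unit (h0 i _) (h1 i _)]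
    · intro i _
      refine Integrable.const_mul (Integrable.of_bound (Measurable.ite measurableSet_Iio
        measurable_const measurable_const).aestronglyMeasurable 1 (.of_forall fun u => ?_)) _
      split_ifs <;> simp
  calc ∑ J : Finset ι, Real.exp (l * ∑ i, signOf J i * a i (θ J))
      ≤ ∑ J : Finset ι, ∫ u, Real.exp (g J u) ∂P := by
        refine Finset.sum_le_sum fun J _ => ?_
        rw [hval]
        exact convexOn_exp.map_integral_le Real.continuous_exp.continuousOn isClosed_univ
          (by simp) (hint J) (hinte J)
    _ = ∫ u, ∑ J : Finset ι, Real.exp (g J u) ∂P := (integral_finsetSum _ fun J _ => hinte J).symm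
    _ ≤ ∫ _, 4 * (2 * Real.cosh l) ^ Fintype.card ι ∂P := by
        refine integral_mono (integrable_finsetSum _ fun J _ => hinte J) (integrable_const _) ?_
        intro u
        exact sum_exp_indicator_le (fun i x => u < a i x)
          (fun i x y hxy h => h.trans_le (ha i hxy)) l T θ hθ
    _ = _ := by simp

/-! ### Uniform deviations of empirical means of monotone functions -/

theorem measurable_sup'_exp {E : Type*} [MeasurableSpace E] {T : Finset ℝ} (hT : T.Nonempty)
    {v : E → ℝ → ℝ} (hv : ∀ x, Measurable fun e => v e x) :
    Measurable fun e => T.sup' hT (fun x => Real.exp (v e x)) := by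
  have h := Finset.measurable_sup' (s := T) hT (f := fun x e => Real.exp (v e x))
    (fun x _ => (hv x).exp)
  have he : (fun e => T.sup' hT (fun x => Real.exp (v e x))) =
      T.sup' hT (fun x e => Real.exp (v e x)) := by
    ext e
    rw [Finset.sup'_apply]
  rw [he]
  exact h

theorem sup'_exp_nonneg {T : Finset ℝ} (hT : T.Nonempty) (v : ℝ → ℝ) :
    0 ≤ T.sup' hT (fun x => Real.exp (v x)) := by
  obtain ⟨x, hx⟩ := hT
  exact (Real.exp_pos _).le.trans (Finset.le_sup' (fun x => Real.exp (v x)) hx)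

theorem integrable_sup'_exp {E : Type*} [MeasurableSpace E] {T : Finset ℝ} (hT : T.Nonempty)
    {v : E → ℝ → ℝ} (hv : ∀ x, Measurable fun e => v e x) {B : ℝ} (hB : ∀ e x, |v e x| ≤ B)
    (P : Measure E) [IsFiniteMeasure P] :
    Integrable (fun e => T.sup' hT (fun x => Real.exp (v e x))) P := by
  refine Integrable.of_bound (measurable_sup'_exp hT hv).aestronglyMeasurable (Real.exp B)
    (.of_forall fun e => ?_)
  rw [Real.norm_of_nonneg (sup'_exp_nonneg hT _)]
  exact Finset.sup'_le _ _ fun x _ => Real.exp_le_exp.2 ((le_abs_self _).trans (hB e x))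

section Symmetrization

variable {E : Type*} [MeasurableSpace E] {n : ℕ} {a : E → ℝ → ℝ}

theorem abs_mul_sum_le {n : ℕ} {d : Fin n → ℝ} (l : ℝ) (hd : ∀ i, |d i| ≤ 1) :
    |l * ∑ i, d i| ≤ |l| * n := by
  rw [abs_mul]
  refine mul_le_mul_of_nonneg_left ((Finset.abs_sum_le_sum_abs _ _).trans ?_) (abs_nonneg _)
  calc ∑ i, |d i| ≤ ∑ _i : Fin n, (1 : ℝ) := Finset.sum_le_sum fun i _ => hd i
    _ = _ := by simp

/-- Exchange the two components of the pairs whose index is not in `J`. -/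
def swapOff {n : ℕ} (J : Finset (Fin n)) (w : Fin n → E × E) : Fin n → E × E :=
  fun i => if i ∈ J then w i else (w i).swap

theorem measurePreserving_swapOff (ν : Measure E) [IsProbabilityMeasure ν] (J : Finset (Fin n)) :
    MeasurePreserving (swapOff (E := E) J) (Measure.pi fun _ => ν.prod ν)
      (Measure.pi fun _ => ν.prod ν) := by
  have h : ∀ i : Fin n, MeasurePreserving (fun p : E × E => if i ∈ J then p else p.swap)
      (ν.prod ν) (ν.prod ν) := fun i => by
    by_cases hi : i ∈ J
    · simp only [if_pos hi]; exact MeasurePreserving.id _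
    · simp only [if_neg hi]; exact Measure.measurePreserving_swap
  exact measurePreserving_pi _ _ h

/-- The maximiser for each `J` is taken as selection `θ J`. Then `exp (A - B) ≤ (exp (2 A) + exp (-2
B)) / 2` separates the two members of the pairs, so that each half is a signed sum of monotone
functions; this is where `l` becomes `2 * l`. -/
theorem sum_sup'_exp_signs_le {E : Type*} {n : ℕ} {a : E → ℝ → ℝ} (ha : ∀ e, Monotone (a e)) (h0 : ∀ e x, 0 ≤ a e x)
    (h1 : ∀ e x, a e x ≤ 1) {T : Finset ℝ} (hT : T.Nonempty) (l : ℝ) (w : Fin n → E × E) :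
    ∑ J : Finset (Fin n), T.sup' hT (fun x => Real.exp
      (l * ∑ i, signOf J i * (a (w i).1 x - a (w i).2 x))) ≤ 4 * (2 * Real.cosh (2 * l)) ^ n := by
  have hsel : ∀ J : Finset (Fin n), ∃ y ∈ T, T.sup' hT (fun x => Real.exp
      (l * ∑ i, signOf J i * (a (w i).1 x - a (w i).2 x))) =
      Real.exp (l * ∑ i, signOf J i * (a (w i).1 y - a (w i).2 y)) := fun J =>
    Finset.exists_mem_eq_sup' hT _
  choose θ hθ hsup using hsel
  have e1 := sum_exp_monotone_le (fun i => a (w i).1) (fun i => ha _) (fun i => h0 _)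
    (fun i => h1 _) (2 * l) T θ hθ
  have e2 := sum_exp_monotone_le (fun i => a (w i).2) (fun i => ha _) (fun i => h0 _)
    (fun i => h1 _) (-(2 * l)) T θ hθ
  rw [Real.cosh_neg] at e2
  rw [Fintype.card_fin] at e1 e2
  have key : ∀ J : Finset (Fin n), T.sup' hT (fun x => Real.exp
      (l * ∑ i, signOf J i * (a (w i).1 x - a (w i).2 x))) ≤
      (Real.exp (2 * l * ∑ i, signOf J i * a (w i).1 (θ J)) +
        Real.exp (-(2 * l) * ∑ i, signOf J i * a (w i).2 (θ J))) / 2 := fun J => by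
    rw [hsup]
    set A := ∑ i, signOf J i * a (w i).1 (θ J)
    set B := ∑ i, signOf J i * a (w i).2 (θ J)
    have : ∑ i, signOf J i * (a (w i).1 (θ J) - a (w i).2 (θ J)) = A - B := by
      simp only [A, B, mul_sub, Finset.sum_sub_distrib]
    rw [this]
    have hA : Real.exp (2 * l * A) = Real.exp (l * A) ^ 2 := by
      rw [← Real.exp_nat_mul]; push_cast; ring_nf
    have hB : Real.exp (-(2 * l) * B) = Real.exp (-l * B) ^ 2 := by
      rw [← Real.exp_nat_mul]; push_cast; ring_nf
    rw [hA, hB, show l * (A - B) = l * A + -l * B by ring, Real.exp_add]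
    nlinarith [sq_nonneg (Real.exp (l * A) - Real.exp (-l * B))]
  calc _ ≤ ∑ J : Finset (Fin n), (Real.exp (2 * l * ∑ i, signOf J i * a (w i).1 (θ J)) +
        Real.exp (-(2 * l) * ∑ i, signOf J i * a (w i).2 (θ J))) / 2 :=
        Finset.sum_le_sum fun J _ => key J
    _ ≤ _ := by
        rw [← Finset.sum_div, Finset.sum_add_distrib]
        linarith

/-- Symmetrization: exchanging the members of some of the pairs preserves their law and flips the
corresponding signs. The integral is therefore its own average over all `2 ^ n` sign patterns, and
for fixed pairs this average is bounded by `sum_sup'_exp_signs_le`. -/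
theorem integral_sup'_exp_pairs_le (ν : Measure E) [IsProbabilityMeasure ν]
    (hm : ∀ x, Measurable fun e => a e x) (ha : ∀ e, Monotone (a e)) (h0 : ∀ e x, 0 ≤ a e x)
    (h1 : ∀ e x, a e x ≤ 1) {T : Finset ℝ} (hT : T.Nonempty) (l : ℝ) :
    ∫ w : Fin n → E × E, T.sup' hT (fun x => Real.exp
      (l * ∑ i, (a (w i).1 x - a (w i).2 x))) ∂(Measure.pi fun _ => ν.prod ν) ≤
      4 * Real.cosh (2 * l) ^ n := by
  let Q : Measure (Fin n → E × E) := Measure.pi fun _ => ν.prod ν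
  let G : Finset (Fin n) → (Fin n → E × E) → ℝ := fun J w => T.sup' hT (fun x => Real.exp
      (l * ∑ i, signOf J i * (a (w i).1 x - a (w i).2 x)))
  have hv : ∀ (J : Finset (Fin n)) x, Measurable fun w : Fin n → E × E =>
      l * ∑ i, signOf J i * (a (w i).1 x - a (w i).2 x) := fun J x => by
    refine Measurable.const_mul (Finset.measurable_sum _ fun i _ => Measurable.const_mul ?_ _) _
    exact ((hm x).comp (measurable_fst.comp (measurable_pi_apply i))).sub
      ((hm x).comp (measurable_snd.comp (measurable_pi_apply i)))
  have hG : ∀ J, Integrable (G J) Q := fun J =>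
    integrable_sup'_exp hT (hv J) (B := |l| * n) (fun w x => abs_mul_sum_le l fun i => by
      rw [abs_mul, abs_signOf, one_mul, abs_le]
      constructor <;> linarith [h0 (w i).1 x, h0 (w i).2 x, h1 (w i).1 x, h1 (w i).2 x]) Q
  have hsym : ∀ J, ∫ w, T.sup' hT (fun x => Real.exp
      (l * ∑ i, (a (w i).1 x - a (w i).2 x))) ∂Q = ∫ w, G J w ∂Q := fun J => by
    have hp : MeasurePreserving (swapOff J) Q Q := measurePreserving_swapOff ν J
    conv_lhs => rw [← hp.map_eq]
    rw [integral_map hp.measurable.aemeasurable]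
    · congr 1
      ext w
      refine Finset.sup'_congr hT rfl fun x _ => congrArg (fun y => Real.exp (l * y))
        (Finset.sum_congr rfl fun i _ => ?_)
      by_cases hi : i ∈ J
      · simp [swapOff, signOf, hi]
      · simp [swapOff, signOf, hi]
    · have := measurable_sup'_exp hT (hv Finset.univ)
      simp only [signOf, Finset.mem_univ, if_true, one_mul] at this
      exact this.aestronglyMeasurable
  have h2 : (2 : ℝ) ^ n * ∫ w, T.sup' hT (fun x => Real.exp
      (l * ∑ i, (a (w i).1 x - a (w i).2 x))) ∂Q ≤ 4 * (2 * Real.cosh (2 * l)) ^ n := by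
    calc _ = ∑ J : Finset (Fin n), ∫ w, G J w ∂Q := by
          rw [← Finset.sum_congr rfl fun J _ => hsym J, Finset.sum_const, Finset.card_univ,
            Fintype.card_finset, Fintype.card_fin, nsmul_eq_mul]
          push_cast
          rfl
      _ = ∫ w, ∑ J : Finset (Fin n), G J w ∂Q := (integral_finsetSum _ fun J _ => hG J).symm
      _ ≤ ∫ _, 4 * (2 * Real.cosh (2 * l)) ^ n ∂Q :=
          integral_mono (integrable_finsetSum _ fun J _ => hG J) (integrable_const _)
            fun w => sum_sup'_exp_signs_le ha h0 h1 hT l w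
      _ = _ := by simp
  rw [mul_pow] at h2
  have : (0 : ℝ) < 2 ^ n := by positivity
  nlinarith

/-- Exponential moment of the largest deviation of an empirical mean from the mean. -/
theorem integral_sup'_exp_deviation_le (ν : Measure E) [IsProbabilityMeasure ν]
    (hm : ∀ x, Measurable fun e => a e x) (ha : ∀ e, Monotone (a e)) (h0 : ∀ e x, 0 ≤ a e x)
    (h1 : ∀ e x, a e x ≤ 1) {T : Finset ℝ} (hT : T.Nonempty) (l : ℝ) :
    ∫ e : Fin n → E, T.sup' hT (fun x => Real.exp
      (l * ∑ i, (a (e i) x - ∫ y, a y x ∂ν))) ∂(Measure.pi fun _ => ν) ≤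
      4 * Real.cosh (2 * l) ^ n := by
  refine le_trans ?_ (integral_sup'_exp_pairs_le (n := n) ν hm ha h0 h1 hT l)
  let P : Measure (Fin n → E) := Measure.pi fun _ => ν
  have hint : ∀ x, Integrable (fun y => a y x) ν := fun x =>
    Integrable.of_bound (hm x).aestronglyMeasurable 1 (.of_forall fun y => by
      rw [Real.norm_of_nonneg (h0 y x)]; exact h1 y x)
  have hm0 : ∀ x, 0 ≤ ∫ y, a y x ∂ν := fun x => integral_nonneg fun y => h0 y x
  have hm1 : ∀ x, ∫ y, a y x ∂ν ≤ 1 := fun x => by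
    calc ∫ y, a y x ∂ν ≤ ∫ _, (1 : ℝ) ∂ν := integral_mono (hint x) (integrable_const _)
          fun y => h1 y x
      _ = 1 := by simp
  let H : (Fin n → E) × (Fin n → E) → ℝ := fun p => T.sup' hT (fun x => Real.exp
      (l * ∑ i, (a (p.1 i) x - a (p.2 i) x)))
  have hv : ∀ x, Measurable fun p : (Fin n → E) × (Fin n → E) =>
      l * ∑ i, (a (p.1 i) x - a (p.2 i) x) := fun x => by
    refine Measurable.const_mul (Finset.measurable_sum _ fun i _ => ?_) _
    exact ((hm x).comp ((measurable_pi_apply i).comp measurable_fst)).sub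
      ((hm x).comp ((measurable_pi_apply i).comp measurable_snd))
  have hbd : ∀ (p : (Fin n → E) × (Fin n → E)) x,
      |l * ∑ i, (a (p.1 i) x - a (p.2 i) x)| ≤ |l| * n := fun p x => abs_mul_sum_le l fun i => by
    rw [abs_le]
    constructor <;> linarith [h0 (p.1 i) x, h0 (p.2 i) x, h1 (p.1 i) x, h1 (p.2 i) x]
  have hH : Integrable H (P.prod P) := integrable_sup'_exp hT hv hbd _
  have hpair : ∫ w : Fin n → E × E, T.sup' hT (fun x => Real.exp
      (l * ∑ i, (a (w i).1 x - a (w i).2 x))) ∂(Measure.pi fun _ => ν.prod ν) =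
      ∫ e, ∫ e', H (e, e') ∂P ∂P := by
    rw [← integral_prod H hH]
    have := (measurePreserving_arrowProdEquivProdArrow E E (Fin n) (fun _ => ν)
      (fun _ => ν)).integral_comp' H
    exact this
  rw [hpair]
  refine integral_mono (integrable_sup'_exp hT (B := |l| * n) (fun x => ?_) (fun e x => ?_) P)
    hH.integral_prod_left fun e => ?_
  · refine Measurable.const_mul (Finset.measurable_sum _ fun i _ => ?_) _
    exact ((hm x).comp (measurable_pi_apply i)).sub measurable_const
  · refine abs_mul_sum_le l fun i => ?_
    rw [abs_le]
    constructor <;> linarith [h0 (e i) x, hm0 x, h1 (e i) x, hm1 x]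
  · refine Finset.sup'_le _ _ fun x hx => ?_
    have hve : Measurable fun e' : Fin n → E => l * ∑ i, (a (e i) x - a (e' i) x) :=
      (hv x).comp measurable_prodMk_left
    have hie : Integrable (fun e' : Fin n → E => Real.exp (l * ∑ i, (a (e i) x - a (e' i) x))) P :=
      Integrable.of_bound hve.exp.aestronglyMeasurable (Real.exp (|l| * n))
        (.of_forall fun e' => by
          rw [Real.norm_eq_abs, Real.abs_exp]
          exact Real.exp_le_exp.2 ((le_abs_self _).trans (hbd (e, e') x)))
    -- The mean is an expectation over an independent copy `e'` of the sample. Jensen takes this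
    -- expectation out of the exponential, and passing to the supremum over thresholds under the
    -- integral only increases the result.
    have hval : l * ∑ i, (a (e i) x - ∫ y, a y x ∂ν) =
        ∫ e', l * ∑ i, (a (e i) x - a (e' i) x) ∂P := by
      have hev : ∀ i : Fin n, MeasurePreserving (fun e' : Fin n → E => e' i) P ν := fun i =>
        measurePreserving_eval (fun _ => ν) i
      have hii : ∀ i : Fin n, Integrable (fun e' : Fin n → E => a (e' i) x) P := fun i =>
        (hev i).integrable_comp_of_integrable (hint x)
      rw [integral_const_mul, integral_finsetSum]
      · congr 1
        refine Finset.sum_congr rfl fun i _ => ?_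
        rw [integral_sub (integrable_const _) (hii i)]
        congr 1
        · simp
        · rw [← (hev i).map_eq, integral_map (hev i).measurable.aemeasurable
            (hm x).aestronglyMeasurable]
      · intro i _
        exact (integrable_const _).sub (hii i)
    rw [hval]
    refine (convexOn_exp.map_integral_le Real.continuous_exp.continuousOn isClosed_univ
      (by simp) (Integrable.of_bound hve.aestronglyMeasurable (|l| * n)
        (.of_forall fun e' => hbd (e, e') x)) hie).trans ?_
    refine integral_mono hie (integrable_sup'_exp hT (fun x => (hv x).comp measurable_prodMk_left)
      (fun e' x => hbd (e, e') x) P) fun e' => ?_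
    exact Finset.le_sup' (fun x => Real.exp (l * ∑ i, (a (e i) x - a (e' i) x))) hx

variable {Ω : Type*} [MeasurableSpace Ω] {μ : Measure Ω} [IsProbabilityMeasure μ]

/-- Tail bound for the largest deviation over finitely many thresholds. -/
theorem measure_exists_mem_deviation_le (ν : Measure E) [IsProbabilityMeasure ν]
    (hm : ∀ x, Measurable fun e => a e x) (ha : ∀ e, Monotone (a e)) (h0 : ∀ e x, 0 ≤ a e x)
    (h1 : ∀ e x, a e x ≤ 1) (T : Finset ℝ) (hn : 0 < n) {X : Fin n → Ω → E}
    (hX : ∀ i, HasLaw (X i) ν μ) (hind : iIndepFun X μ) (t : ℝ) :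
    μ {ω | ∃ x ∈ T, t / √n + ∫ y, a y x ∂ν < (n : ℝ)⁻¹ * ∑ i, a (X i ω) x} ≤
      ENNReal.ofReal (32 * Real.exp (-t)) := by
  rcases T.eq_empty_or_nonempty with rfl | hT
  · simp
  -- With this choice a deviation of `t / √n` has exponent `t`, while `cosh (2 * l) ^ n ≤ exp 2 ≤ 8`
  -- for every `n`. The constant `32` is `4 * 8`.
  let l : ℝ := (√n)⁻¹
  have hn' : (0 : ℝ) < n := by exact_mod_cast hn
  have hs : 0 < √(n : ℝ) := Real.sqrt_pos.2 hn'
  have hss : √(n : ℝ) * √n = n := Real.mul_self_sqrt hn'.le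
  let P : Measure (Fin n → E) := Measure.pi fun _ => ν
  let F : (Fin n → E) → ℝ := fun e => T.sup' hT (fun x => Real.exp
      (l * ∑ i, (a (e i) x - ∫ y, a y x ∂ν)))
  have hint : ∀ x, Integrable (fun y => a y x) ν := fun x =>
    Integrable.of_bound (hm x).aestronglyMeasurable 1 (.of_forall fun y => by
      rw [Real.norm_of_nonneg (h0 y x)]; exact h1 y x)
  have hm0 : ∀ x, 0 ≤ ∫ y, a y x ∂ν := fun x => integral_nonneg fun y => h0 y x
  have hm1 : ∀ x, ∫ y, a y x ∂ν ≤ 1 := fun x => by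
    calc ∫ y, a y x ∂ν ≤ ∫ _, (1 : ℝ) ∂ν := integral_mono (hint x) (integrable_const _)
          fun y => h1 y x
      _ = 1 := by simp
  have hv : ∀ x, Measurable fun e : Fin n → E => l * ∑ i, (a (e i) x - ∫ y, a y x ∂ν) :=
    fun x => by
    refine Measurable.const_mul (Finset.measurable_sum _ fun i _ => ?_) _
    exact ((hm x).comp (measurable_pi_apply i)).sub measurable_const
  have hFm : Measurable F := measurable_sup'_exp hT hv
  have hFi : Integrable F P := integrable_sup'_exp hT (B := |l| * n) hv (fun e x => by
    refine abs_mul_sum_le l fun i => ?_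
    rw [abs_le]
    constructor <;> linarith [h0 (e i) x, hm0 x, h1 (e i) x, hm1 x]) P
  have hlaw : μ.map (fun ω i => X i ω) = P := by
    rw [(iIndepFun_iff_map_fun_eq_pi_map fun i => (hX i).aemeasurable).1 hind]
    congr 1
    ext i : 1
    exact (hX i).map_eq
  have hsub : {ω | ∃ x ∈ T, t / √n + ∫ y, a y x ∂ν < (n : ℝ)⁻¹ * ∑ i, a (X i ω) x} ⊆
      (fun ω i => X i ω) ⁻¹' {e | Real.exp t ≤ F e} := by
    rintro ω ⟨x, hx, hlt⟩
    refine le_trans ?_ (Finset.le_sup' (fun x => Real.exp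
      (l * ∑ i, (a (X i ω) x - ∫ y, a y x ∂ν))) hx)
    refine Real.exp_le_exp.2 ?_
    rw [Finset.sum_sub_distrib, Finset.sum_const, Finset.card_univ, Fintype.card_fin,
      nsmul_eq_mul]
    set A := ∑ i, a (X i ω) x
    set m := ∫ y, a y x ∂ν
    rw [← sub_pos] at hlt
    have : l * (A - n * m) = √n * ((n : ℝ)⁻¹ * A - m) := by
      simp only [l]
      field_simp
      rw [pow_two, hss]
    rw [this]
    have h3 : t = √n * (t / √n) := by field_simp
    rw [h3]
    refine mul_le_mul_of_nonneg_left ?_ hs.le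
    rw [h3, mul_div_cancel_left₀ _ hs.ne'] at hlt
    linarith
  have hmark := mul_meas_ge_le_integral_of_nonneg
    (.of_forall fun e => sup'_exp_nonneg hT _) hFi (Real.exp t)
  have hcosh : Real.cosh (2 * l) ^ n ≤ Real.exp 2 := by
    calc Real.cosh (2 * l) ^ n ≤ Real.exp ((2 * l) ^ 2 / 2) ^ n :=
          pow_le_pow_left₀ (Real.cosh_pos _).le (Real.cosh_le_exp_half_sq _) n
      _ = Real.exp 2 := by
          rw [← Real.exp_nat_mul]
          congr 1
          simp only [l]
          field_simp
          rw [Real.sq_sqrt hn'.le]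
  have he2 : Real.exp 2 ≤ 8 := by
    have : Real.exp 2 = Real.exp 1 ^ 2 := by rw [← Real.exp_nat_mul]; norm_num
    rw [this]
    have := Real.exp_one_lt_d9
    nlinarith [Real.exp_pos 1]
  have hbound := integral_sup'_exp_deviation_le (n := n) ν hm ha h0 h1 hT l
  have hreal : P.real {e | Real.exp t ≤ F e} ≤ 32 * Real.exp (-t) := by
    rw [Real.exp_neg, ← div_eq_mul_inv, le_div_iff₀ (Real.exp_pos t), mul_comm]
    exact hmark.trans (hbound.trans (by linarith))
  calc μ _ ≤ μ ((fun ω i => X i ω) ⁻¹' {e | Real.exp t ≤ F e}) := measure_mono hsub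
    _ = P {e | Real.exp t ≤ F e} := by
        rw [← hlaw, Measure.map_apply_of_aemeasurable
          (aemeasurable_pi_lambda _ fun i => (hX i).aemeasurable)
          (measurableSet_le measurable_const hFm)]
    _ ≤ _ := by
        rw [← ofReal_measureReal]
        exact ENNReal.ofReal_le_ofReal hreal

/-- A one-sided Dvoretzky–Kiefer–Wolfowitz type inequality with exponential tails, for families of
monotone right-continuous functions with values in the unit interval. -/
theorem measure_exists_deviation_le (ν : Measure E) [IsProbabilityMeasure ν]
    (hm : ∀ x, Measurable fun e => a e x) (ha : ∀ e, Monotone (a e)) (h0 : ∀ e x, 0 ≤ a e x)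
    (h1 : ∀ e x, a e x ≤ 1) (hr : ∀ e x, ContinuousWithinAt (a e) (Ici x) x) (hn : 0 < n)
    {X : Fin n → Ω → E} (hX : ∀ i, HasLaw (X i) ν μ) (hind : iIndepFun X μ) (t : ℝ) :
    μ {ω | ∃ x, t / √n + ∫ y, a y x ∂ν < (n : ℝ)⁻¹ * ∑ i, a (X i ω) x} ≤
      ENNReal.ofReal (32 * Real.exp (-t)) := by
  obtain ⟨q, hq⟩ := exists_surjective_nat ℚ
  let T : ℕ → Finset ℝ := fun k => (Finset.range k).image fun j => (q j : ℝ)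
  let B : ℕ → Set Ω := fun k =>
    {ω | ∃ x ∈ T k, t / √n + ∫ y, a y x ∂ν < (n : ℝ)⁻¹ * ∑ i, a (X i ω) x}
  have hB : Monotone B := by
    rintro k k' hk ω ⟨x, hx, h⟩
    exact ⟨x, Finset.image_subset_image (Finset.range_mono hk) hx, h⟩
  -- Both sides of the strict inequality are right-continuous in `x`, so a violation at `x` persists
  -- on some `[x, y)` and is seen at a rational threshold. The finite sets `T k` increase to all
  -- rationals.
  have hsub : {ω | ∃ x, t / √n + ∫ y, a y x ∂ν < (n : ℝ)⁻¹ * ∑ i, a (X i ω) x} ⊆ ⋃ k, B k := by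
    rintro ω ⟨x, hx⟩
    have hc1 : ContinuousWithinAt (fun x => t / √n + ∫ y, a y x ∂ν) (Ici x) x := by
      refine continuousWithinAt_const.add
        (tendsto_integral_filter_of_dominated_convergence (fun _ => 1)
        (.of_forall fun x => (hm x).aestronglyMeasurable) (.of_forall fun x => .of_forall fun y => ?_)
        (integrable_const _) (.of_forall fun y => hr y x))
      rw [Real.norm_of_nonneg (h0 y x)]; exact h1 y x
    have hc2 : ContinuousWithinAt (fun x => (n : ℝ)⁻¹ * ∑ i, a (X i ω) x) (Ici x) x :=
      continuousWithinAt_const.mul (tendsto_finsetSum _ fun i _ => hr (X i ω) x)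
    have hev := Filter.Tendsto.eventually_lt hc1 hc2 hx
    obtain ⟨y, hy, hxy⟩ := (mem_nhdsGE_iff_exists_Ico_subset).1 hev
    obtain ⟨r, hr1, hr2⟩ := exists_rat_btwn (show x < y from hy)
    obtain ⟨j, rfl⟩ := hq r
    refine mem_iUnion.2 ⟨j + 1, q j, ?_, hxy ⟨hr1.le, hr2⟩⟩
    exact Finset.mem_image.2 ⟨j, Finset.self_mem_range_succ j, rfl⟩
  refine (measure_mono hsub).trans ?_
  rw [hB.measure_iUnion]
  exact iSup_le fun k => measure_exists_mem_deviation_le ν hm ha h0 h1 (T k) hn hX hind t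

end Symmetrization

/-! ### Laws on a compact interval and the `L¹` distance of distribution functions -/

/-- `ν` is a probability distribution on `[lo, hi]`. -/
def IsLawOn (lo hi : ℝ) (ν : Measure ℝ) : Prop := IsProbabilityMeasure ν ∧ ν (Icc lo hi) = 1

/-- The `L¹` distance of distribution functions. -/
noncomputable def cdfDist (ν ν' : Measure ℝ) : ℝ := ∫ x, |cdf ν x - cdf ν' x|

section LawOn

variable {lo hi : ℝ} {ν ν' ν'' : Measure ℝ}

theorem IsLawOn.ae_mem (h : IsLawOn lo hi ν) : ∀ᵐ x ∂ν, x ∈ Icc lo hi := by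
  have := h.1
  exact (prob_compl_eq_zero_iff measurableSet_Icc).2 h.2

theorem isLawOn_of_ae_mem [hν : IsProbabilityMeasure ν] (h : ∀ᵐ x ∂ν, x ∈ Icc lo hi) :
    IsLawOn lo hi ν :=
  ⟨hν, (prob_compl_eq_zero_iff measurableSet_Icc).1 h⟩

theorem IsLawOn.le (h : IsLawOn lo hi ν) : lo ≤ hi := by
  have := h.1
  obtain ⟨x, hx⟩ := h.ae_mem.exists
  exact hx.1.trans hx.2

theorem IsLawOn.cdf_eq_zero (h : IsLawOn lo hi ν) {x : ℝ} (hx : x < lo) : cdf ν x = 0 := by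
  have := h.1
  rw [cdf_eq_real, measureReal_def, measure_mono_null _ h.ae_mem, ENNReal.toReal_zero]
  intro y hy h'
  exact absurd (h'.1.trans hy) (not_le.2 hx)

theorem IsLawOn.cdf_eq_one (h : IsLawOn lo hi ν) {x : ℝ} (hx : hi ≤ x) : cdf ν x = 1 := by
  have := h.1
  rw [cdf_eq_real, measureReal_def, le_antisymm prob_le_one
    (h.2 ▸ measure_mono fun y hy => hy.2.trans hx), ENNReal.toReal_one]

theorem IsLawOn.cdf_sub_eq_zero (h : IsLawOn lo hi ν) (h' : IsLawOn lo hi ν') {x : ℝ}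
    (hx : x ∉ Icc lo hi) : cdf ν x - cdf ν' x = 0 := by
  rcases lt_or_ge x lo with h1 | h1
  · rw [h.cdf_eq_zero h1, h'.cdf_eq_zero h1, sub_zero]
  · have h2 : hi ≤ x := (not_le.1 fun h2 => hx ⟨h1, h2⟩).le
    rw [h.cdf_eq_one h2, h'.cdf_eq_one h2, sub_self]

theorem abs_cdf_sub_le_one (x : ℝ) : |cdf ν x - cdf ν' x| ≤ 1 := by
  rw [abs_le]
  constructor <;> linarith [cdf_nonneg ν x, cdf_nonneg ν' x, cdf_le_one ν x, cdf_le_one ν' x]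

theorem measurable_cdf (ν : Measure ℝ) : Measurable (cdf ν) := (monotone_cdf ν).measurable

theorem IsLawOn.integrable_cdf_sub (h : IsLawOn lo hi ν) (h' : IsLawOn lo hi ν') :
    Integrable (fun x => cdf ν x - cdf ν' x) := by
  refine IntegrableOn.integrable_of_forall_notMem_eq_zero (s := Icc lo hi) ?_
    fun x hx => h.cdf_sub_eq_zero h' hx
  exact Integrable.of_bound ((measurable_cdf ν).sub (measurable_cdf ν')).aestronglyMeasurable 1
    (.of_forall fun x => abs_cdf_sub_le_one x)

theorem cdfDist_nonneg : 0 ≤ cdfDist ν ν' := integral_nonneg fun _ => abs_nonneg _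

theorem cdfDist_comm : cdfDist ν ν' = cdfDist ν' ν := by
  unfold cdfDist
  simp_rw [abs_sub_comm]

theorem IsLawOn.cdfDist_triangle (h : IsLawOn lo hi ν) (h' : IsLawOn lo hi ν')
    (h'' : IsLawOn lo hi ν'') : cdfDist ν ν'' ≤ cdfDist ν ν' + cdfDist ν' ν'' := by
  unfold cdfDist
  rw [← integral_add (h.integrable_cdf_sub h').abs (h'.integrable_cdf_sub h'').abs]
  exact integral_mono (h.integrable_cdf_sub h'').abs
    ((h.integrable_cdf_sub h').abs.add (h'.integrable_cdf_sub h'').abs)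
    fun x => abs_sub_le _ _ _

/-- The distribution functions agree almost everywhere, hence at points arbitrarily close to any `x`
on its right, and right continuity gives equality at `x`. -/
theorem IsLawOn.eq_of_cdfDist_eq_zero (h : IsLawOn lo hi ν) (h' : IsLawOn lo hi ν')
    (h0 : cdfDist ν ν' = 0) : ν = ν' := by
  have := h.1
  have := h'.1
  refine Measure.eq_of_cdf _ _ (StieltjesFunction.ext fun x => ?_)
  have hae : (fun x => |cdf ν x - cdf ν' x|) =ᵐ[volume] 0 :=
    (integral_eq_zero_iff_of_nonneg (fun _ => abs_nonneg _) (h.integrable_cdf_sub h').abs).1 h0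
  have hfreq : ∃ᶠ y in 𝓝[>] x, cdf ν y = cdf ν' y := by
    intro hne
    obtain ⟨y, hy, hsub⟩ := (mem_nhdsGT_iff_exists_Ioo_subset).1 hne
    have hnull : volume (Ioo x y) = 0 := by
      refine measure_mono_null (fun z hz => ?_) hae
      intro hz'
      exact hsub hz (sub_eq_zero.1 (abs_eq_zero.1 hz'))
    rw [Real.volume_Ioo, ENNReal.ofReal_eq_zero] at hnull
    exact absurd (show x < y from hy) (not_lt.2 (by linarith))
  have hc : ∀ ρ : Measure ℝ, Tendsto (cdf ρ) (𝓝[>] x) (𝓝 (cdf ρ x)) := fun ρ =>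
    ((cdf ρ).right_continuous x).mono_left (nhdsWithin_mono _ Ioi_subset_Ici_self)
  by_contra hne
  obtain ⟨y, hy1, hy2⟩ := (hfreq.and_eventually
    (((hc ν).sub (hc ν')).eventually_ne (sub_ne_zero.2 hne))).exists
  exact hy2 (sub_eq_zero.2 hy1)

/-- Differences of distribution functions lie in `[-1, 1]`, where squaring does not increase the
absolute value. The `L¹` distance, which suits CVaR as well, can thus replace the Cramér distance
throughout. -/
theorem IsLawOn.integral_sq_cdf_sub_le (h : IsLawOn lo hi ν) (h' : IsLawOn lo hi ν') :
    ∫ x, (cdf ν x - cdf ν' x) ^ 2 ≤ cdfDist ν ν' := by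
  refine integral_mono_of_nonneg (.of_forall fun x => sq_nonneg _)
    (h.integrable_cdf_sub h').abs (.of_forall fun x => ?_)
  have := abs_cdf_sub_le_one (ν := ν) (ν' := ν') x
  change (cdf ν x - cdf ν' x) ^ 2 ≤ |cdf ν x - cdf ν' x|
  rw [← sq_abs]
  nlinarith [abs_nonneg (cdf ν x - cdf ν' x)]

/-! ### Conditional value at risk -/

theorem IsLawOn.integrable_max (h : IsLawOn lo hi ν) (t : ℝ) :
    Integrable (fun x => max (t - x) 0) ν := by
  have := h.1
  refine Integrable.of_bound (by fun_prop) (|t| + |lo|) ?_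
  filter_upwards [h.ae_mem] with x hx
  rw [Real.norm_of_nonneg (le_max_right _ _)]
  refine max_le ?_ (by positivity)
  linarith [le_abs_self t, neg_abs_le lo, hx.1]

/-- Layer cake: for `u > 0` the event `u ≤ (t - X)⁺` is `X ≤ t - u`. CVaR thereby becomes antitone
in the distribution function and Lipschitz for the `L¹` distance. -/
theorem IsLawOn.integral_max_eq (h : IsLawOn lo hi ν) (t : ℝ) :
    ∫ x, max (t - x) 0 ∂ν = ∫ u in Ioi (0 : ℝ), cdf ν (t - u) := by
  have := h.1
  rw [(h.integrable_max t).integral_eq_integral_meas_le (.of_forall fun x => le_max_right _ _)]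
  refine setIntegral_congr_fun measurableSet_Ioi fun u hu => ?_
  rw [cdf_eq_real]
  congr 1
  ext x
  simp only [mem_ofPred_eq, mem_Iic, le_max_iff]
  constructor
  · rintro (h | h)
    · linarith
    · exact absurd h (not_le.2 hu)
  · intro h
    left; linarith

theorem IsLawOn.integrableOn_cdf_sub (h : IsLawOn lo hi ν) (t : ℝ) :
    IntegrableOn (fun u => cdf ν (t - u)) (Ioi 0) := by
  have h1 : IntegrableOn (fun u => cdf ν (t - u)) (Ioc 0 (t - lo)) :=
    Integrable.of_bound ((measurable_cdf ν).comp (by fun_prop)).aestronglyMeasurable 1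
      (.of_forall fun x => by
        rw [Real.norm_of_nonneg (cdf_nonneg _ _)]; exact cdf_le_one _ _)
  refine IntegrableOn.of_forall_sdiff_eq_zero h1 measurableSet_Ioi fun u hu => ?_
  refine h.cdf_eq_zero ?_
  have : ¬ u ≤ t - lo := fun h' => hu.2 ⟨hu.1, h'⟩
  linarith

theorem IsLawOn.integral_max_mono (h : IsLawOn lo hi ν) (h' : IsLawOn lo hi ν')
    (hle : ∀ x, cdf ν x ≤ cdf ν' x) (t : ℝ) :
    ∫ x, max (t - x) 0 ∂ν ≤ ∫ x, max (t - x) 0 ∂ν' := by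
  rw [h.integral_max_eq, h'.integral_max_eq]
  exact integral_mono (h.integrableOn_cdf_sub t) (h'.integrableOn_cdf_sub t) fun u => hle _

theorem IsLawOn.integral_max_le_add (h : IsLawOn lo hi ν) (h' : IsLawOn lo hi ν') (t : ℝ) :
    ∫ x, max (t - x) 0 ∂ν ≤ ∫ x, max (t - x) 0 ∂ν' + cdfDist ν ν' := by
  have hi := (h.integrable_cdf_sub h').abs.comp_sub_left t
  have e : cdfDist ν ν' = ∫ u, |cdf ν (t - u) - cdf ν' (t - u)| :=
    (integral_sub_left_eq_self (fun x => |cdf ν x - cdf ν' x|) volume t).symm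
  rw [h.integral_max_eq, h'.integral_max_eq, ← sub_le_iff_le_add',
    ← integral_sub (h.integrableOn_cdf_sub t) (h'.integrableOn_cdf_sub t), e]
  refine (integral_mono ((h.integrableOn_cdf_sub t).sub (h'.integrableOn_cdf_sub t))
    hi.integrableOn fun u => le_abs_self _).trans ?_
  exact setIntegral_le_integral hi (.of_forall fun u => abs_nonneg _)

/-- The bound is `hi`, because `𝔼 (t - X)⁺ ≥ t - hi` and `α⁻¹ ≥ 1`. Boundedness matters because the
real supremum of an unbounded family is `0` by convention. -/
theorem IsLawOn.bddAbove_cvar (h : IsLawOn lo hi ν) {α : ℝ} (hα : 0 < α) (hα1 : α ≤ 1) :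
    BddAbove (range fun t : ℝ => t - α⁻¹ * ∫ x, max (t - x) 0 ∂ν) := by
  have := h.1
  refine ⟨hi, ?_⟩
  rintro _ ⟨t, rfl⟩
  have hinv : 1 ≤ α⁻¹ := (one_le_inv₀ hα).2 hα1
  have h0 : 0 ≤ ∫ x, max (t - x) 0 ∂ν := integral_nonneg fun x => le_max_right _ _
  have h1 : t - hi ≤ ∫ x, max (t - x) 0 ∂ν := by
    calc t - hi = ∫ _, (t - hi) ∂ν := by simp
      _ ≤ _ := integral_mono_ae (integrable_const _) (h.integrable_max t) (by
        filter_upwards [h.ae_mem] with x hx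
        exact le_max_of_le_left (by linarith [hx.2]))
  change t - α⁻¹ * ∫ x, max (t - x) 0 ∂ν ≤ hi
  nlinarith

theorem IsLawOn.cvar_mono (h : IsLawOn lo hi ν) (h' : IsLawOn lo hi ν')
    (hle : ∀ x, cdf ν x ≤ cdf ν' x) {α : ℝ} (hα : 0 < α) (hα1 : α ≤ 1) :
    cvar α ν' ≤ cvar α ν := by
  refine ciSup_mono (h.bddAbove_cvar hα hα1) fun t => ?_
  have := mul_le_mul_of_nonneg_left (h.integral_max_mono h' hle t) (inv_pos.2 hα).le
  linarith

theorem IsLawOn.cvar_le_add (h : IsLawOn lo hi ν) (h' : IsLawOn lo hi ν')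
    {α : ℝ} (hα : 0 < α) (hα1 : α ≤ 1) : cvar α ν ≤ cvar α ν' + α⁻¹ * cdfDist ν ν' := by
  refine ciSup_le fun t => ?_
  have h1 := le_ciSup (h'.bddAbove_cvar hα hα1) t
  have h2 := mul_le_mul_of_nonneg_left (h'.integral_max_le_add h t) (inv_pos.2 hα).le
  rw [cdfDist_comm, mul_add] at h2
  have h3 : t - α⁻¹ * ∫ x, max (t - x) 0 ∂ν' ≤ cvar α ν' := h1
  linarith

theorem tendsto_cvar {ν : ℕ → Measure ℝ} (h : ∀ m, IsLawOn lo hi (ν m)) (h' : IsLawOn lo hi ν')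
    (hd : Tendsto (fun m => cdfDist (ν m) ν') atTop (𝓝 0)) {α : ℝ} (hα : 0 < α) (hα1 : α ≤ 1) :
    Tendsto (fun m => cvar α (ν m)) atTop (𝓝 (cvar α ν')) := by
  rw [tendsto_iff_dist_tendsto_zero]
  have h0 : Tendsto (fun m => α⁻¹ * cdfDist (ν m) ν') atTop (𝓝 0) := by
    simpa using hd.const_mul α⁻¹
  refine squeeze_zero (fun _ => dist_nonneg) (fun m => ?_) h0
  rw [Real.dist_eq, abs_le]
  have h1 := (h m).cvar_le_add h' hα hα1
  have h2 := h'.cvar_le_add (h m) hα hα1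
  rw [cdfDist_comm] at h2
  constructor <;> linarith

end LawOn

/-! ### Fixed points of monotone contractions -/

section FixedPoint

variable {lo hi : ℝ}

/-- The pointwise limit of a decreasing sequence of distribution functions of laws on a compact
interval is the distribution function of a law on this interval. -/
theorem exists_isLawOn_tendsto_cdf {ν : ℕ → Measure ℝ} (h : ∀ m, IsLawOn lo hi (ν m))
    (hanti : ∀ x, Antitone fun m => cdf (ν m) x) :
    ∃ ν', IsLawOn lo hi ν' ∧ ∀ x, Tendsto (fun m => cdf (ν m) x) atTop (𝓝 (cdf ν' x)) := by
  have hbdd : ∀ x, BddBelow (range fun m => cdf (ν m) x) := fun x =>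
    ⟨0, by rintro _ ⟨m, rfl⟩; exact cdf_nonneg _ _⟩
  let G : ℝ → ℝ := fun x => ⨅ m, cdf (ν m) x
  have hG : Monotone G := fun x y hxy => ciInf_mono (hbdd x) fun m => monotone_cdf _ hxy
  let F : StieltjesFunction ℝ :=
    { toFun := G
      mono' := hG
      right_continuous' := fun x => by
        refine tendsto_order.2 ⟨fun c hc => ?_, fun c hc => ?_⟩
        · filter_upwards [self_mem_nhdsWithin] with y hy
          exact hc.trans_le (hG hy)
        -- An infimum of upper semicontinuous functions is upper semicontinuous, which for a
        -- monotone function amounts to right continuity.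
        · obtain ⟨m, hm⟩ := exists_lt_of_ciInf_lt hc
          filter_upwards [((cdf (ν m)).right_continuous x).eventually_lt_const hm] with y hy
          exact (ciInf_le (hbdd y) m).trans_lt hy }
  have hbot : ∀ x < lo, F x = 0 := fun x hx => by
    change ⨅ m, cdf (ν m) x = 0
    simp [(h _).cdf_eq_zero hx]
  have htop : ∀ x, hi ≤ x → F x = 1 := fun x hx => by
    change ⨅ m, cdf (ν m) x = 1
    simp [(h _).cdf_eq_one hx]
  have hF0 : Tendsto F atBot (𝓝 0) := tendsto_const_nhds.congr' (by
    filter_upwards [Iio_mem_atBot lo] with x hx using (hbot x hx).symm)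
  have hF1 : Tendsto F atTop (𝓝 1) := tendsto_const_nhds.congr' (by
    filter_upwards [Ici_mem_atTop hi] with x hx using (htop x hx).symm)
  refine ⟨F.measure, ⟨F.isProbabilityMeasure hF0 hF1, ?_⟩, fun x => ?_⟩
  · have hl : Function.leftLim F lo = 0 := by
      refine leftLim_eq_of_tendsto ?_
      refine tendsto_const_nhds.congr' ?_
      filter_upwards [self_mem_nhdsWithin] with x hx using (hbot x hx).symm
    rw [StieltjesFunction.measure_Icc, hl, htop hi le_rfl]
    simp
  · rw [cdf_measure_stieltjesFunction _ hF0 hF1]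
    exact tendsto_atTop_ciInf (hanti x) (hbdd x)

theorem tendsto_cdfDist_of_tendsto_cdf {ν : ℕ → Measure ℝ} {ν' : Measure ℝ}
    (h : ∀ m, IsLawOn lo hi (ν m)) (h' : IsLawOn lo hi ν')
    (hlim : ∀ x, Tendsto (fun m => cdf (ν m) x) atTop (𝓝 (cdf ν' x))) :
    Tendsto (fun m => cdfDist (ν m) ν') atTop (𝓝 0) := by
  have : Tendsto (fun m => ∫ x, |cdf (ν m) x - cdf ν' x|) atTop (𝓝 (∫ _ : ℝ, (0 : ℝ))) := by
    refine tendsto_integral_of_dominated_convergence ((Icc lo hi).indicator fun _ => 1)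
      (fun m => ((h m).integrable_cdf_sub h').abs.aestronglyMeasurable)
      ((integrable_indicator_iff measurableSet_Icc).2 (integrableOn_const (by simp)))
      (fun m => .of_forall fun x => ?_) (.of_forall fun x => ?_)
    · by_cases hx : x ∈ Icc lo hi
      · rw [indicator_of_mem hx, Real.norm_eq_abs, abs_abs]
        exact abs_cdf_sub_le_one x
      · rw [indicator_of_notMem hx, (h m).cdf_sub_eq_zero h' hx]
        simp
    · have := ((hlim x).sub_const (cdf ν' x)).abs
      simpa using this
  rwa [integral_zero] at this

variable {S A : Type*} {γ : ℝ}
  {U : (S → A → Measure ℝ) → (S → A → Measure ℝ)}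

theorem isLawOn_iterate
    (hU : ∀ Z, (∀ s a, IsLawOn lo hi (Z s a)) → ∀ s a, IsLawOn lo hi (U Z s a))
    {Z : S → A → Measure ℝ} (hZ : ∀ s a, IsLawOn lo hi (Z s a)) (m : ℕ) :
    ∀ s a, IsLawOn lo hi (U^[m] Z s a) := by
  induction m with
  | zero => exact hZ
  | succ m ih => rw [Function.iterate_succ_apply']; exact hU _ ih

theorem cdf_iterate_le
    (hU : ∀ Z, (∀ s a, IsLawOn lo hi (Z s a)) → ∀ s a, IsLawOn lo hi (U Z s a))
    (hmono : ∀ Z Z', (∀ s a, IsLawOn lo hi (Z s a)) → (∀ s a, IsLawOn lo hi (Z' s a)) →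
      (∀ s a x, cdf (Z s a) x ≤ cdf (Z' s a) x) → ∀ s a x, cdf (U Z s a) x ≤ cdf (U Z' s a) x)
    {Z : S → A → Measure ℝ} (hZ : ∀ s a, IsLawOn lo hi (Z s a))
    (hle : ∀ s a x, cdf (U Z s a) x ≤ cdf (Z s a) x) (m : ℕ) :
    ∀ s a x, cdf (U^[m + 1] Z s a) x ≤ cdf (U^[m] Z s a) x := by
  induction m with
  | zero => exact hle
  | succ m ih =>
    rw [Function.iterate_succ_apply' U m, Function.iterate_succ_apply' U (m + 1)]
    exact hmono _ _ (isLawOn_iterate hU hZ _) (isLawOn_iterate hU hZ _) ih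

variable [Finite S] [Finite A]

theorem tendsto_cdfDist_iterate (hγ0 : 0 ≤ γ) (hγ1 : γ < 1)
    (hU : ∀ Z, (∀ s a, IsLawOn lo hi (Z s a)) → ∀ s a, IsLawOn lo hi (U Z s a))
    (hcontr : ∀ Z Z' d, (∀ s a, IsLawOn lo hi (Z s a)) → (∀ s a, IsLawOn lo hi (Z' s a)) →
      (∀ s a, cdfDist (Z s a) (Z' s a) ≤ d) → ∀ s a, cdfDist (U Z s a) (U Z' s a) ≤ γ * d)
    {Z Z' : S → A → Measure ℝ} (hZ : ∀ s a, IsLawOn lo hi (Z s a))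
    (hZ' : ∀ s a, IsLawOn lo hi (Z' s a)) (hfix : U Z' = Z') (s : S) (a : A) :
    Tendsto (fun m => cdfDist (U^[m] Z s a) (Z' s a)) atTop (𝓝 0) := by
  obtain ⟨d, hd⟩ : ∃ d, ∀ p : S × A, cdfDist (Z p.1 p.2) (Z' p.1 p.2) ≤ d := by
    obtain ⟨d, hd⟩ := (finite_range fun p : S × A => cdfDist (Z p.1 p.2) (Z' p.1 p.2)).bddAbove
    exact ⟨d, fun p => hd ⟨p, rfl⟩⟩
  have hm : ∀ m : ℕ, ∀ s a, cdfDist (U^[m] Z s a) (Z' s a) ≤ γ ^ m * d := by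
    intro m
    induction m with
    | zero => intro s a; simpa using hd (s, a)
    | succ m ih =>
      intro s a
      have := hcontr _ _ _ (isLawOn_iterate hU hZ m) hZ' ih s a
      rw [hfix] at this
      rw [Function.iterate_succ_apply', pow_succ', mul_assoc]
      exact this
  have h0 : Tendsto (fun m : ℕ => γ ^ m * d) atTop (𝓝 0) := by
    simpa using (tendsto_pow_atTop_nhds_zero_of_lt_one hγ0 hγ1).mul_const d
  exact squeeze_zero (fun _ => cdfDist_nonneg) (fun m => hm m s a) h0

/-- Monotonicity replaces a completeness argument. The point mass at `lo` has the largest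
distribution function, so the iterates from it decrease and converge pointwise, hence in `L¹` by
domination. The contraction estimate is needed here only for continuity of `U`, to identify the
limit as a fixed point. The order `lo ≤ hi` is required only in the presence of a state-action pair.
-/
theorem exists_fixedPoint (hlohi : ∀ (_ : S) (_ : A), lo ≤ hi)
    (hU : ∀ Z, (∀ s a, IsLawOn lo hi (Z s a)) → ∀ s a, IsLawOn lo hi (U Z s a))
    (hmono : ∀ Z Z', (∀ s a, IsLawOn lo hi (Z s a)) → (∀ s a, IsLawOn lo hi (Z' s a)) →
      (∀ s a x, cdf (Z s a) x ≤ cdf (Z' s a) x) → ∀ s a x, cdf (U Z s a) x ≤ cdf (U Z' s a) x)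
    (hcontr : ∀ Z Z' d, (∀ s a, IsLawOn lo hi (Z s a)) → (∀ s a, IsLawOn lo hi (Z' s a)) →
      (∀ s a, cdfDist (Z s a) (Z' s a) ≤ d) → ∀ s a, cdfDist (U Z s a) (U Z' s a) ≤ γ * d) :
    ∃ Z, (∀ s a, IsLawOn lo hi (Z s a)) ∧ U Z = Z := by
  cases nonempty_fintype S
  cases nonempty_fintype A
  let Z₀ : S → A → Measure ℝ := fun _ _ => Measure.dirac lo
  have hZ₀ : ∀ s a, IsLawOn lo hi (Z₀ s a) := fun s a =>
    ⟨inferInstance, by simp [Z₀, hlohi s a]⟩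
  have hle : ∀ s a x, cdf (U Z₀ s a) x ≤ cdf (Z₀ s a) x := fun s a x => by
    rcases lt_or_ge x lo with hx | hx
    · rw [(hU _ hZ₀ s a).cdf_eq_zero hx]; exact cdf_nonneg _ _
    · refine (cdf_le_one _ _).trans (le_of_eq ?_)
      rw [cdf_eq_real]
      simp [Z₀, measureReal_def, hx]
  have hanti : ∀ s a x, Antitone fun m => cdf (U^[m] Z₀ s a) x := fun s a x =>
    antitone_nat_of_succ_le fun m => cdf_iterate_le hU hmono hZ₀ hle m s a x
  have hlaw := fun m => isLawOn_iterate hU hZ₀ m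
  choose Z hZ hlim using fun s a => exists_isLawOn_tendsto_cdf (fun m => hlaw m s a) (hanti s a)
  refine ⟨Z, hZ, ?_⟩
  have hd : ∀ s a, Tendsto (fun m => cdfDist (U^[m] Z₀ s a) (Z s a)) atTop (𝓝 0) := fun s a =>
    tendsto_cdfDist_of_tendsto_cdf (fun m => hlaw m s a) (hZ s a) (hlim s a)
  -- The sum over all pairs serves as the common bound `d` in `hcontr`, in place of a maximum.
  have hsum : Tendsto (fun m => ∑ p : S × A, cdfDist (U^[m] Z₀ p.1 p.2) (Z p.1 p.2)) atTop
      (𝓝 0) := by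
    simpa using tendsto_finsetSum Finset.univ fun (p : S × A) _ => hd p.1 p.2
  ext1 s
  ext1 a
  refine (hU _ hZ s a).eq_of_cdfDist_eq_zero (hZ s a) (le_antisymm ?_ cdfDist_nonneg)
  have hlim' : Tendsto (fun m => γ * ∑ p : S × A, cdfDist (U^[m] Z₀ p.1 p.2) (Z p.1 p.2) +
      cdfDist (U^[m + 1] Z₀ s a) (Z s a)) atTop (𝓝 0) := by
    simpa using (hsum.const_mul γ).add ((tendsto_add_atTop_iff_nat 1).2 (hd s a))
  refine ge_of_tendsto' hlim' fun m => ?_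
  refine ((hU _ hZ s a).cdfDist_triangle (hlaw (m + 1) s a) (hZ s a)).trans ?_
  refine add_le_add_left ?_ _
  rw [cdfDist_comm, Function.iterate_succ_apply']
  exact hcontr _ _ _ (hlaw m) hZ (fun s a => Finset.single_le_sum
    (f := fun p : S × A => cdfDist (U^[m] Z₀ p.1 p.2) (Z p.1 p.2))
    (fun _ _ => cdfDist_nonneg) (Finset.mem_univ (s, a))) s a

theorem fixedPoint_unique (hγ0 : 0 ≤ γ) (hγ1 : γ < 1)
    (hU : ∀ Z, (∀ s a, IsLawOn lo hi (Z s a)) → ∀ s a, IsLawOn lo hi (U Z s a))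
    (hcontr : ∀ Z Z' d, (∀ s a, IsLawOn lo hi (Z s a)) → (∀ s a, IsLawOn lo hi (Z' s a)) →
      (∀ s a, cdfDist (Z s a) (Z' s a) ≤ d) → ∀ s a, cdfDist (U Z s a) (U Z' s a) ≤ γ * d)
    {Z Z' : S → A → Measure ℝ} (hZ : ∀ s a, IsLawOn lo hi (Z s a))
    (hZ' : ∀ s a, IsLawOn lo hi (Z' s a)) (hfix : U Z = Z) (hfix' : U Z' = Z') : Z = Z' := by
  ext1 s
  ext1 a
  have h := tendsto_cdfDist_iterate hγ0 hγ1 hU hcontr hZ hZ' hfix' s a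
  simp only [Function.iterate_fixed hfix] at h
  exact (hZ s a).eq_of_cdfDist_eq_zero (hZ' s a) (tendsto_nhds_unique tendsto_const_nhds h)

theorem tendsto_cramerDist {Z : ℕ → S → A → Measure ℝ} {Z' : S → A → Measure ℝ}
    (hZ : ∀ m s a, IsLawOn lo hi (Z m s a)) (hZ' : ∀ s a, IsLawOn lo hi (Z' s a))
    (h : ∀ s a, Tendsto (fun m => cdfDist (Z m s a) (Z' s a)) atTop (𝓝 0)) :
    Tendsto (fun m => cramerDist (Z m) Z') atTop (𝓝 0) := by
  cases nonempty_fintype S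
  cases nonempty_fintype A
  have hsum : Tendsto (fun m => ∑ p : S × A, √(cdfDist (Z m p.1 p.2) (Z' p.1 p.2))) atTop
      (𝓝 0) := by
    simpa using tendsto_finsetSum Finset.univ fun (p : S × A) _ => (h p.1 p.2).sqrt
  refine squeeze_zero (fun m => Real.iSup_nonneg fun p => Real.sqrt_nonneg _) (fun m => ?_) hsum
  refine Real.iSup_le (fun p => ?_) (Finset.sum_nonneg fun p _ => Real.sqrt_nonneg _)
  refine (Real.sqrt_le_sqrt ((hZ m p.1 p.2).integral_sq_cdf_sub_le (hZ' p.1 p.2))).trans ?_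
  exact Finset.single_le_sum (f := fun p : S × A => √(cdfDist (Z m p.1 p.2) (Z' p.1 p.2)))
    (fun _ _ => Real.sqrt_nonneg _) (Finset.mem_univ p)

end FixedPoint

/-! ### The distributional Bellman operator -/

/-- The law of `r + γ z` for independent `r ∼ ρ` and `z ∼ ν`. -/
noncomputable def affineLaw (ρ : Measure ℝ) (γ : ℝ) (ν : Measure ℝ) : Measure ℝ :=
  (ρ.prod ν).map (fun p : ℝ × ℝ => p.1 + γ * p.2)

/-- The mixture of the laws `Z s a` for `s ∼ P` and `a ∼ π s`. -/
noncomputable def mixedLaw {S A : Type*} [Fintype S] [Fintype A] [MeasurableSpace S]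
    [MeasurableSpace A] (P : Measure S) (π : S → ProbabilityMeasure A) (Z : S → A → Measure ℝ) :
    Measure ℝ :=
  ∑ s : S, ∑ a : A, (P {s} * (π s : Measure A) {a}) • Z s a

section AffineLaw

variable {ρ ν : Measure ℝ} [IsProbabilityMeasure ρ] [IsProbabilityMeasure ν]

instance (γ : ℝ) : IsProbabilityMeasure (affineLaw ρ γ ν) :=
  Measure.isProbabilityMeasure_map (by fun_prop)

theorem measurableSet_affine_le (γ x : ℝ) : MeasurableSet {p : ℝ × ℝ | p.1 + γ * p.2 ≤ x} :=
  measurableSet_le (by fun_prop) measurable_const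

/-- Fubini with the reward outside, suited to comparing different laws `ν`. The set is not rewritten
as a half-line because `γ = 0` is allowed. -/
theorem cdf_affineLaw (γ x : ℝ) :
    cdf (affineLaw ρ γ ν) x = ∫ r, ν.real {z | r + γ * z ≤ x} ∂ρ := by
  have hB := measurableSet_affine_le γ x
  rw [cdf_eq_real, affineLaw, map_measureReal_apply (by fun_prop) measurableSet_Iic,
    ← integral_indicator_one (by exact hB), integral_prod]
  · refine integral_congr_ae (.of_forall fun r => ?_)
    have hs : MeasurableSet {z | r + γ * z ≤ x} := measurableSet_le (by fun_prop) measurable_const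
    change ∫ z, _ ∂ν = ν.real {z | r + γ * z ≤ x}
    rw [← integral_indicator_one hs]
    rfl
  · exact (integrable_const 1).indicator hB

/-- Fubini in the other order: the reward law enters only through its distribution function, and the
expression is linear in `ν`. This suits errors in the reward law and mixtures over next states. -/
theorem cdf_affineLaw' (γ x : ℝ) :
    cdf (affineLaw ρ γ ν) x = ∫ z, cdf ρ (x - γ * z) ∂ν := by
  have hB := measurableSet_affine_le γ x
  rw [cdf_eq_real, affineLaw, map_measureReal_apply (by fun_prop) measurableSet_Iic,
    ← integral_indicator_one (by exact hB), integral_prod_symm]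
  · refine integral_congr_ae (.of_forall fun z => ?_)
    change ∫ r, _ ∂ρ = cdf ρ (x - γ * z)
    rw [cdf_eq_real, ← integral_indicator_one measurableSet_Iic]
    congr 1
    ext r
    simp [indicator, le_sub_iff_add_le]
  · exact (integrable_const 1).indicator hB

theorem integrable_cdf_comp {ρ ν : Measure ℝ} [IsProbabilityMeasure ν] (γ x : ℝ) : Integrable (fun z => cdf ρ (x - γ * z)) ν :=
  Integrable.of_bound ((measurable_cdf ρ).comp (by fun_prop)).aestronglyMeasurable 1
    (.of_forall fun z => by
      rw [Real.norm_of_nonneg (cdf_nonneg _ _)]; exact cdf_le_one _ _)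

theorem measureReal_affine_le_zero (r x : ℝ) :
    ν.real {z | r + 0 * z ≤ x} = if r ≤ x then 1 else 0 := by
  split_ifs with h <;> simp [h]

theorem measureReal_affine_le_of_pos {γ : ℝ} (hγ : 0 < γ) (r x : ℝ) :
    ν.real {z | r + γ * z ≤ x} = cdf ν ((x - r) / γ) := by
  rw [cdf_eq_real]
  congr 1
  ext z
  simp only [mem_ofPred_eq, mem_Iic]
  rw [le_div_iff₀ hγ, mul_comm z, le_sub_iff_add_le']

theorem measureReal_affine_le_mono {ν' : Measure ℝ} [IsProbabilityMeasure ν'] {γ : ℝ}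
    (hγ : 0 ≤ γ) (hle : ∀ x, cdf ν x ≤ cdf ν' x) (r x : ℝ) :
    ν.real {z | r + γ * z ≤ x} ≤ ν'.real {z | r + γ * z ≤ x} := by
  rcases hγ.eq_or_lt with rfl | hγ
  · rw [measureReal_affine_le_zero, measureReal_affine_le_zero]
  · rw [measureReal_affine_le_of_pos hγ, measureReal_affine_le_of_pos hγ]
    exact hle _

theorem IsLawOn.integrable_measureReal_affine_sub {lo hi γ : ℝ} {ν ν' : Measure ℝ}
    (h : IsLawOn lo hi ν) (h' : IsLawOn lo hi ν') (hγ : 0 ≤ γ) (r : ℝ) :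
    Integrable fun x => ν.real {z | r + γ * z ≤ x} - ν'.real {z | r + γ * z ≤ x} := by
  have := h.1
  have := h'.1
  rcases hγ.eq_or_lt with rfl | hγ
  · simp only [measureReal_affine_le_zero, sub_self]
    exact integrable_zero _ _ _
  · simp only [measureReal_affine_le_of_pos hγ]
    exact ((h.integrable_cdf_sub h').comp_div hγ.ne').comp_sub_right r

/-- Source of the contraction factor: Lebesgue measure is invariant under translation by `r` and
scales by `γ` under dilation. For `γ = 0` both sides vanish. -/
theorem IsLawOn.integral_abs_measureReal_affine_sub {lo hi γ : ℝ} {ν ν' : Measure ℝ}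
    (h : IsLawOn lo hi ν) (h' : IsLawOn lo hi ν') (hγ : 0 ≤ γ) (r : ℝ) :
    ∫ x, |ν.real {z | r + γ * z ≤ x} - ν'.real {z | r + γ * z ≤ x}| = γ * cdfDist ν ν' := by
  have := h.1
  have := h'.1
  rcases hγ.eq_or_lt with rfl | hγ
  · simp only [measureReal_affine_le_zero]
    simp
  · simp only [measureReal_affine_le_of_pos hγ]
    rw [integral_sub_right_eq_self (fun x => |cdf ν (x / γ) - cdf ν' (x / γ)|) r,
      Measure.integral_comp_div (fun x => |cdf ν x - cdf ν' x|) γ, abs_of_pos hγ]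
    rfl

theorem measurable_measureReal_affine_le (ν : Measure ℝ) [SFinite ν] (γ x : ℝ) :
    Measurable fun r => ν.real {z | r + γ * z ≤ x} :=
  (measurable_measure_prodMk_left (measurableSet_affine_le γ x)).ennreal_toReal

theorem integrable_sum_measureReal_affine_le {S A : Type*} [Fintype S] [Fintype A]
    {ρ : Measure ℝ} [IsProbabilityMeasure ρ] (w : S → A → ℝ) {Z : S → A → Measure ℝ} (hZ : ∀ s a, IsProbabilityMeasure (Z s a)) (γ x : ℝ) :
    Integrable (fun r => ∑ s', ∑ a', w s' a' * (Z s' a').real {z | r + γ * z ≤ x}) ρ := by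
  refine integrable_finsetSum _ fun s _ => integrable_finsetSum _ fun a _ => ?_
  have := hZ s a
  exact (Integrable.of_bound (measurable_measureReal_affine_le _ γ x).aestronglyMeasurable 1
    (.of_forall fun r => by
      rw [Real.norm_of_nonneg measureReal_nonneg]; exact measureReal_le_one)).const_mul _

end AffineLaw

section MixedLaw

variable {S A : Type*} [Fintype S] [Fintype A] [MeasurableSpace S] [MeasurableSpace A]

theorem distBellman_apply (R : S → A → Measure ℝ) (P : S → A → Measure S)
    (π : S → ProbabilityMeasure A) (γ : ℝ) (Z : S → A → Measure ℝ) (s : S) (a : A) :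
    distBellman R P π γ Z s a = affineLaw (R s a) γ (mixedLaw (P s a) π Z) := rfl

theorem measureReal_mixedLaw (P : Measure S) [IsProbabilityMeasure P]
    (π : S → ProbabilityMeasure A) {Z : S → A → Measure ℝ}
    (hZ : ∀ s a, IsProbabilityMeasure (Z s a)) (B : Set ℝ) :
    (mixedLaw P π Z).real B =
      ∑ s, ∑ a, P.real {s} * (π s : Measure A).real {a} * (Z s a).real B := by
  have hfin : ∀ s a, (P {s} * (π s : Measure A) {a}) * Z s a B ≠ ∞ := fun s a =>
    ENNReal.mul_ne_top (ENNReal.mul_ne_top (measure_ne_top _ _) (measure_ne_top _ _))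
      (measure_ne_top _ _)
  simp only [mixedLaw, measureReal_def, Measure.finsetSum_apply, Measure.smul_apply, smul_eq_mul]
  rw [ENNReal.toReal_sum fun s _ => ENNReal.sum_ne_top.2 fun a _ => hfin s a]
  refine Finset.sum_congr rfl fun s _ => ?_
  rw [ENNReal.toReal_sum fun a _ => hfin s a]
  simp only [ENNReal.toReal_mul]

theorem integral_mixedLaw (P : Measure S) [IsProbabilityMeasure P]
    (π : S → ProbabilityMeasure A) {Z : S → A → Measure ℝ} {f : ℝ → ℝ}
    (hf : ∀ s a, Integrable f (Z s a)) :
    ∫ z, f z ∂(mixedLaw P π Z) =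
      ∑ s, ∑ a, P.real {s} * (π s : Measure A).real {a} * ∫ z, f z ∂(Z s a) := by
  have hfin : ∀ s a, P {s} * (π s : Measure A) {a} ≠ ∞ := fun s a =>
    ENNReal.mul_ne_top (measure_ne_top _ _) (measure_ne_top _ _)
  have hint : ∀ s a, Integrable f ((P {s} * (π s : Measure A) {a}) • Z s a) := fun s a =>
    (hf s a).smul_measure (hfin s a)
  rw [mixedLaw, integral_finsetSum_measure fun s _ =>
    integrable_finsetSum_measure.2 fun a _ => hint s a]
  refine Finset.sum_congr rfl fun s _ => ?_
  rw [integral_finsetSum_measure fun a _ => hint s a]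
  refine Finset.sum_congr rfl fun a _ => ?_
  rw [integral_smul_measure, ENNReal.toReal_mul, smul_eq_mul]
  rfl

theorem ae_mem_mixedLaw (P : Measure S) (π : S → ProbabilityMeasure A) {Z : S → A → Measure ℝ}
    {B : Set ℝ} (hZ : ∀ s a, ∀ᵐ z ∂(Z s a), z ∈ B) : ∀ᵐ z ∂(mixedLaw P π Z), z ∈ B := by
  change mixedLaw P π Z Bᶜ = 0
  have : ∀ s a, Z s a Bᶜ = 0 := hZ
  simp [mixedLaw, this]

variable [MeasurableSingletonClass S] [MeasurableSingletonClass A]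

theorem sum_mixed_weights (P : Measure S) [IsProbabilityMeasure P]
    (π : S → ProbabilityMeasure A) :
    ∑ s, ∑ a, P.real {s} * (π s : Measure A).real {a} = 1 := by
  have hA : ∀ s, ∑ a : A, (π s : Measure A).real {a} = 1 := fun s => by
    rw [sum_measureReal_singleton]
    simp
  have hS : ∑ s : S, P.real {s} = 1 := by simp
  simp only [← Finset.mul_sum, hA, mul_one, hS]

theorem isProbabilityMeasure_mixedLaw (P : Measure S) [IsProbabilityMeasure P]
    (π : S → ProbabilityMeasure A) {Z : S → A → Measure ℝ}
    (hZ : ∀ s a, IsProbabilityMeasure (Z s a)) : IsProbabilityMeasure (mixedLaw P π Z) := by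
  refine ⟨?_⟩
  have h : (mixedLaw P π Z).real univ = 1 := by
    rw [measureReal_mixedLaw P π hZ]
    simpa using sum_mixed_weights P π
  exact (ENNReal.toReal_eq_one_iff _).1 h

/-- The equations for `lo` and `hi` say that the extreme rewards reproduce the endpoints of the
interval, so `r + γ z` cannot leave it. -/
theorem isLawOn_distBellman {R : S → A → Measure ℝ} {P : S → A → Measure S}
    (π : S → ProbabilityMeasure A) {γ rlo rhi lo hi : ℝ} (hγ : 0 ≤ γ)
    (hlo : lo = rlo + γ * lo) (hhi : hi = rhi + γ * hi)
    (hR : ∀ s a, IsLawOn rlo rhi (R s a)) (hP : ∀ s a, IsProbabilityMeasure (P s a))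
    {Z : S → A → Measure ℝ} (hZ : ∀ s a, IsLawOn lo hi (Z s a)) (s : S) (a : A) :
    IsLawOn lo hi (distBellman R P π γ Z s a) := by
  have h1 := (hR s a).1
  have h2 := hP s a
  have h3 := isProbabilityMeasure_mixedLaw (P s a) π fun s a => (hZ s a).1
  rw [distBellman_apply]
  refine isLawOn_of_ae_mem ?_
  refine (ae_map_iff (p := fun x => x ∈ Icc lo hi) (by fun_prop) measurableSet_Icc).2 ?_
  have e1 : ∀ᵐ p ∂((R s a).prod (mixedLaw (P s a) π Z)), p.1 ∈ Icc rlo rhi :=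
    Measure.quasiMeasurePreserving_fst.ae (hR s a).ae_mem
  have e2 : ∀ᵐ p ∂((R s a).prod (mixedLaw (P s a) π Z)), p.2 ∈ Icc lo hi :=
    Measure.quasiMeasurePreserving_snd.ae (ae_mem_mixedLaw _ π fun s a => (hZ s a).ae_mem)
  filter_upwards [e1, e2] with p h1 h2
  have m1 := mul_le_mul_of_nonneg_left h2.1 hγ
  have m2 := mul_le_mul_of_nonneg_left h2.2 hγ
  constructor <;> linarith [h1.1, h1.2]

theorem cdf_distBellman {R : S → A → Measure ℝ} {P : S → A → Measure S}
    (π : S → ProbabilityMeasure A) (γ : ℝ) (hR : ∀ s a, IsProbabilityMeasure (R s a))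
    (hP : ∀ s a, IsProbabilityMeasure (P s a)) {Z : S → A → Measure ℝ}
    (hZ : ∀ s a, IsProbabilityMeasure (Z s a)) (s : S) (a : A) (x : ℝ) :
    cdf (distBellman R P π γ Z s a) x = ∫ r, ∑ s', ∑ a', (P s a).real {s'} *
      (π s' : Measure A).real {a'} * (Z s' a').real {z | r + γ * z ≤ x} ∂(R s a) := by
  have h1 := hR s a
  have h2 := hP s a
  have h3 := isProbabilityMeasure_mixedLaw (P s a) π hZ
  rw [distBellman_apply, cdf_affineLaw]
  simp only [measureReal_mixedLaw (P s a) π hZ]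

theorem cdf_distBellman_mono {R : S → A → Measure ℝ} {P : S → A → Measure S}
    (π : S → ProbabilityMeasure A) {γ : ℝ} (hγ : 0 ≤ γ)
    (hR : ∀ s a, IsProbabilityMeasure (R s a)) (hP : ∀ s a, IsProbabilityMeasure (P s a))
    {Z Z' : S → A → Measure ℝ} (hZ : ∀ s a, IsProbabilityMeasure (Z s a))
    (hZ' : ∀ s a, IsProbabilityMeasure (Z' s a))
    (hle : ∀ s a x, cdf (Z s a) x ≤ cdf (Z' s a) x) (s : S) (a : A) (x : ℝ) :
    cdf (distBellman R P π γ Z s a) x ≤ cdf (distBellman R P π γ Z' s a) x := by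
  have h1 := hR s a
  rw [cdf_distBellman π γ hR hP hZ, cdf_distBellman π γ hR hP hZ']
  refine integral_mono (integrable_sum_measureReal_affine_le _ hZ γ x)
    (integrable_sum_measureReal_affine_le _ hZ' γ x) fun r => ?_
  refine Finset.sum_le_sum fun s' _ => Finset.sum_le_sum fun a' _ => ?_
  have := hZ s' a'
  have := hZ' s' a'
  exact mul_le_mul_of_nonneg_left (measureReal_affine_le_mono hγ (hle s' a') r x)
    (mul_nonneg measureReal_nonneg measureReal_nonneg)

end MixedLaw

/-! ### Empirical measures -/

section Empirical

variable {X : Type*} [MeasurableSpace X] {n : ℕ}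

theorem isProbabilityMeasure_empiricalMeasure (hn : 0 < n) (x : Fin n → X) :
    IsProbabilityMeasure (empiricalMeasure x) := by
  refine ⟨?_⟩
  simp only [empiricalMeasure, Measure.smul_apply, Measure.finsetSum_apply, measure_univ,
    Finset.sum_const, Finset.card_univ, Fintype.card_fin, smul_eq_mul, nsmul_eq_mul, mul_one]
  exact ENNReal.inv_mul_cancel (by exact_mod_cast hn.ne') (by simp)

theorem integral_empiricalMeasure [MeasurableSingletonClass X] (x : Fin n → X) {f : X → ℝ} :
    ∫ y, f y ∂(empiricalMeasure x) = (n : ℝ)⁻¹ * ∑ i, f (x i) := by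
  rw [empiricalMeasure, integral_smul_measure, integral_finsetSum_measure]
  · simp
  · intro i _
    exact integrable_dirac (by simp)

theorem ae_mem_empiricalMeasure {x : Fin n → X} {B : Set X} (hB : MeasurableSet B)
    (h : ∀ i, x i ∈ B) : ∀ᵐ y ∂(empiricalMeasure x), y ∈ B := by
  change empiricalMeasure x Bᶜ = 0
  simp [empiricalMeasure, hB.compl, h]

end Empirical

/-! ### Contraction of the Bellman operator with empirical rewards -/

section Contraction

variable {S A : Type*} [Fintype S] [Fintype A] [MeasurableSpace S] [MeasurableSpace A]
  [MeasurableSingletonClass S] [MeasurableSingletonClass A]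

/-- The difference of the new distribution functions is an average, over sampled rewards and over
next state-action pairs, of differences translated and dilated by `γ`. The triangle inequality
inside the integral then gives the factor `γ`. Empirical reward laws make the outer average a finite
sum, which can be exchanged with the integral directly. -/
theorem cdfDist_distBellman_le {n : S → A → ℕ} (hn : ∀ s a, 0 < n s a)
    (r : (s : S) → (a : A) → Fin (n s a) → ℝ) {P : S → A → Measure S}
    (π : S → ProbabilityMeasure A) {γ lo hi d : ℝ} (hγ : 0 ≤ γ)
    (hP : ∀ s a, IsProbabilityMeasure (P s a)) {Z Z' : S → A → Measure ℝ}
    (hZ : ∀ s a, IsLawOn lo hi (Z s a)) (hZ' : ∀ s a, IsLawOn lo hi (Z' s a))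
    (hd : ∀ s a, cdfDist (Z s a) (Z' s a) ≤ d) (s : S) (a : A) :
    cdfDist (distBellman (fun s a => empiricalMeasure (r s a)) P π γ Z s a)
      (distBellman (fun s a => empiricalMeasure (r s a)) P π γ Z' s a) ≤ γ * d := by
  have hR : ∀ s a, IsProbabilityMeasure (empiricalMeasure (r s a)) := fun s a =>
    isProbabilityMeasure_empiricalMeasure (hn s a) _
  have hn' : (0 : ℝ) < n s a := by exact_mod_cast hn s a
  have h2 := hP s a
  let w : S → A → ℝ := fun s' a' => (P s a).real {s'} * (π s' : Measure A).real {a'}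
  have hw : ∀ s' a', 0 ≤ w s' a' := fun s' a' => mul_nonneg measureReal_nonneg measureReal_nonneg
  let D : Fin (n s a) → S → A → ℝ → ℝ := fun i s' a' x =>
    (Z s' a').real {z | r s a i + γ * z ≤ x} - (Z' s' a').real {z | r s a i + γ * z ≤ x}
  have hD : ∀ i s' a', Integrable fun x => w s' a' * |D i s' a' x| := fun i s' a' =>
    ((hZ s' a').integrable_measureReal_affine_sub (hZ' s' a') hγ _).abs.const_mul _
  have hDi : ∀ i, Integrable fun x => ∑ s', ∑ a', w s' a' * |D i s' a' x| := fun i =>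
    integrable_finsetSum _ fun s' _ => integrable_finsetSum _ fun a' _ => hD i s' a'
  have key : ∀ x, |cdf (distBellman (fun s a => empiricalMeasure (r s a)) P π γ Z s a) x -
      cdf (distBellman (fun s a => empiricalMeasure (r s a)) P π γ Z' s a) x| ≤
      (n s a : ℝ)⁻¹ * ∑ i, ∑ s', ∑ a', w s' a' * |D i s' a' x| := fun x => by
    rw [cdf_distBellman π γ hR hP fun s a => (hZ s a).1,
      cdf_distBellman π γ hR hP fun s a => (hZ' s a).1, integral_empiricalMeasure,
      integral_empiricalMeasure, ← mul_sub, ← Finset.sum_sub_distrib, abs_mul,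
      abs_of_pos (inv_pos.2 hn')]
    refine mul_le_mul_of_nonneg_left ?_ (inv_pos.2 hn').le
    refine (Finset.abs_sum_le_sum_abs _ _).trans (Finset.sum_le_sum fun i _ => ?_)
    rw [← Finset.sum_sub_distrib]
    refine (Finset.abs_sum_le_sum_abs _ _).trans (Finset.sum_le_sum fun s' _ => ?_)
    rw [← Finset.sum_sub_distrib]
    refine (Finset.abs_sum_le_sum_abs _ _).trans (Finset.sum_le_sum fun a' _ => ?_)
    rw [← mul_sub, abs_mul, abs_of_nonneg (mul_nonneg measureReal_nonneg measureReal_nonneg)]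
  calc _ ≤ ∫ x, (n s a : ℝ)⁻¹ * ∑ i, ∑ s', ∑ a', w s' a' * |D i s' a' x| :=
        integral_mono_of_nonneg (.of_forall fun x => abs_nonneg _)
          ((integrable_finsetSum _ fun i _ => hDi i).const_mul _) (.of_forall key)
    _ = (n s a : ℝ)⁻¹ * ∑ i : Fin (n s a), ∑ s', ∑ a', w s' a' *
          (γ * cdfDist (Z s' a') (Z' s' a')) := by
        rw [integral_const_mul, integral_finsetSum _ fun i _ => hDi i]
        congr 1
        refine Finset.sum_congr rfl fun i _ => ?_
        rw [integral_finsetSum _ fun s' _ => integrable_finsetSum _ fun a' _ => hD i s' a']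
        refine Finset.sum_congr rfl fun s' _ => ?_
        rw [integral_finsetSum _ fun a' _ => hD i s' a']
        refine Finset.sum_congr rfl fun a' _ => ?_
        rw [integral_const_mul,
          (hZ s' a').integral_abs_measureReal_affine_sub (hZ' s' a') hγ]
    _ ≤ (n s a : ℝ)⁻¹ * ∑ i : Fin (n s a), ∑ s', ∑ a', w s' a' * (γ * d) := by
        refine mul_le_mul_of_nonneg_left ?_ (inv_pos.2 hn').le
        exact Finset.sum_le_sum fun i _ => Finset.sum_le_sum fun s' _ => Finset.sum_le_sum
          fun a' _ => mul_le_mul_of_nonneg_left (mul_le_mul_of_nonneg_left (hd s' a') hγ)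
            (hw s' a')
    _ = γ * d := by
        simp only [← Finset.sum_mul, w, sum_mixed_weights (P s a) π]
        simp
        field_simp

end Contraction

/-! ### The optimism operator -/

section Optimism

variable {lo hi : ℝ} {ν ν' : Measure ℝ}

theorem isLawOn_optimisticLaw (h : IsLawOn lo hi ν) (k : ℝ≥0) :
    IsLawOn lo hi (optimisticLaw hi k ν) := by
  have := h.1
  have hcdf := cdf_optimisticLaw lo hi k ν h.2
  have hval : ∀ x < lo, shiftedCDF hi k ν x = 0 := fun x hx => by
    change (if x < hi then max (cdf ν x - k) 0 else 1) = 0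
    rw [if_pos (hx.trans_le h.le), h.cdf_eq_zero hx]
    simp
  have htop : ∀ x, hi ≤ x → shiftedCDF hi k ν x = 1 := fun x hx => if_neg (not_lt.2 hx)
  have hF0 : Tendsto (shiftedCDF hi k ν) atBot (𝓝 0) := tendsto_const_nhds.congr' (by
    filter_upwards [Iio_mem_atBot lo] with x hx using (hval x hx).symm)
  have hF1 : Tendsto (shiftedCDF hi k ν) atTop (𝓝 1) := tendsto_const_nhds.congr' (by
    filter_upwards [Ici_mem_atTop hi] with x hx using (htop x hx).symm)
  refine ⟨(shiftedCDF hi k ν).isProbabilityMeasure hF0 hF1, ?_⟩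
  have hl : Function.leftLim (shiftedCDF hi k ν) lo = 0 := by
    refine leftLim_eq_of_tendsto ?_
    refine tendsto_const_nhds.congr' ?_
    filter_upwards [self_mem_nhdsWithin] with x hx using (hval x hx).symm
  rw [optimisticLaw, StieltjesFunction.measure_Icc, hl, htop hi le_rfl]
  simp

theorem cdf_optimisticLaw_mono (h : IsLawOn lo hi ν) (h' : IsLawOn lo hi ν') (k : ℝ≥0)
    (hle : ∀ x, cdf ν x ≤ cdf ν' x) (x : ℝ) :
    cdf (optimisticLaw hi k ν) x ≤ cdf (optimisticLaw hi k ν') x := by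
  have := h.1
  have := h'.1
  rw [cdf_optimisticLaw lo hi k ν h.2, cdf_optimisticLaw lo hi k ν' h'.2]
  exact max_le_max (sub_le_sub_right (hle x) _) le_rfl

theorem cdfDist_optimisticLaw_le (h : IsLawOn lo hi ν) (h' : IsLawOn lo hi ν') (k : ℝ≥0) :
    cdfDist (optimisticLaw hi k ν) (optimisticLaw hi k ν') ≤ cdfDist ν ν' := by
  have := h.1
  have := h'.1
  refine integral_mono
    ((isLawOn_optimisticLaw h k).integrable_cdf_sub (isLawOn_optimisticLaw h' k)).abs
    (h.integrable_cdf_sub h').abs fun x => ?_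
  change |cdf (optimisticLaw hi k ν) x - cdf (optimisticLaw hi k ν') x| ≤ |cdf ν x - cdf ν' x|
  rw [cdf_optimisticLaw lo hi k ν h.2, cdf_optimisticLaw lo hi k ν' h'.2]
  refine (abs_max_sub_max_le_abs _ _ _).trans (le_of_eq ?_)
  congr 1
  ring

/-- The shift absorbs any one-sided error of size `k`. Off `[lo, hi)`, where nothing is shifted, the
two distribution functions are both `0` or both `1`. -/
theorem cdf_optimisticLaw_le (h : IsLawOn lo hi ν) (h' : IsLawOn lo hi ν') {k : ℝ≥0}
    (hle : ∀ x, cdf ν x ≤ cdf ν' x + k) (x : ℝ) :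
    cdf (optimisticLaw hi k ν) x ≤ cdf ν' x := by
  have := h.1
  rcases lt_or_ge x hi with hx | hx
  · rcases lt_or_ge x lo with hx' | hx'
    · rw [(isLawOn_optimisticLaw h k).cdf_eq_zero hx']
      exact cdf_nonneg _ _
    · rw [cdf_optimisticLaw lo hi k ν h.2, indicator_of_mem (show x ∈ Ico lo hi from ⟨hx', hx⟩)]
      exact max_le (by linarith [hle x]) (cdf_nonneg _ _)
  · rw [h'.cdf_eq_one hx]
    exact cdf_le_one _ _

end Optimism

/-! ### The distributional Bellman equation for the law of the return -/

section LIntegral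

variable {S A : Type*} [Fintype S] [Fintype A] [MeasurableSpace S] [MeasurableSpace A]

theorem lintegral_mixedLaw (P : Measure S) (π : S → ProbabilityMeasure A)
    (Z : S → A → Measure ℝ) (f : ℝ → ℝ≥0∞) :
    ∫⁻ z, f z ∂(mixedLaw P π Z) =
      ∑ s, ∑ a, P {s} * (π s : Measure A) {a} * ∫⁻ z, f z ∂(Z s a) := by
  simp only [mixedLaw, lintegral_finsetSum_measure, lintegral_smul_measure, smul_eq_mul]

theorem lintegral_affineLaw (ρ ν : Measure ℝ) [SFinite ρ] [SFinite ν] (γ : ℝ) {f : ℝ → ℝ≥0∞}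
    (hf : Measurable f) :
    ∫⁻ u, f u ∂(affineLaw ρ γ ν) = ∫⁻ r, ∫⁻ z, f (r + γ * z) ∂ν ∂ρ := by
  rw [affineLaw, lintegral_map hf (by fun_prop), lintegral_prod _ (by fun_prop)]

theorem mixedLaw_const [MeasurableSingletonClass S] [MeasurableSingletonClass A] (P : Measure S)
    [IsProbabilityMeasure P] (π : S → ProbabilityMeasure A) (ν : Measure ℝ)
    [IsProbabilityMeasure ν] : mixedLaw P π (fun _ _ => ν) = ν := by
  have := isProbabilityMeasure_mixedLaw P π (Z := fun _ _ => ν) fun _ _ => inferInstance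
  refine Measure.ext fun B _ => ?_
  have h : (mixedLaw P π fun _ _ => ν).real B = ν.real B := by
    rw [measureReal_mixedLaw P π fun _ _ => inferInstance]
    simp only [← Finset.sum_mul, sum_mixed_weights P π, one_mul]
  exact (measureReal_eq_measureReal_iff).1 h

end LIntegral

namespace RewardMDP

variable {S A : Type*} [MeasurableSpace S]

/-- The discounted sum of the first `k` rewards of a trajectory. -/
noncomputable def partialReturn (M : RewardMDP S A) (k : ℕ) (x : ℕ → S × A × ℝ) : ℝ :=
  ∑ t ∈ Finset.range k, M.discount ^ t * (x t).2.2

theorem summable_rewards (M : RewardMDP S A) {x : ℕ → S × A × ℝ} (hx : ∀ t, (x t).2.2 ∈ Icc M.rmin M.rmax) :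
    Summable fun t => M.discount ^ t * (x t).2.2 := by
  refine Summable.of_norm_bounded (g := fun t => M.discount ^ t * max |M.rmin| |M.rmax|)
    ((summable_geometric_of_lt_one M.discount_nonneg M.discount_lt_one).mul_right _) fun t => ?_
  rw [norm_mul, norm_pow, Real.norm_of_nonneg M.discount_nonneg]
  exact mul_le_mul_of_nonneg_left (abs_le_max_abs_abs (hx t).1 (hx t).2)
    (pow_nonneg M.discount_nonneg _)

variable [MeasurableSpace A]

theorem measurable_partialReturn (M : RewardMDP S A) (k : ℕ) : Measurable (M.partialReturn k) := by
  unfold partialReturn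
  fun_prop

variable [Fintype S] [Fintype A]

/-- The distributional Bellman operator of the true model. -/
noncomputable def bellman (M : RewardMDP S A) (π : S → ProbabilityMeasure A) :
    (S → A → Measure ℝ) → (S → A → Measure ℝ) :=
  distBellman (fun s a => (M.reward s a : Measure ℝ)) (fun s a => (M.trans s a : Measure S)) π
    M.discount

/-- The law of the discounted sum of the first `j` rewards, defined through the distributional
Bellman operator. -/
noncomputable def partialReturnLaw (M : RewardMDP S A) (π : S → ProbabilityMeasure A) (j : ℕ) :
    S → A → Measure ℝ :=
  (M.bellman π)^[j] fun _ _ => Measure.dirac 0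

variable (M : RewardMDP S A) (π : S → ProbabilityMeasure A)

theorem bellman_apply (Z : S → A → Measure ℝ) (s : S) (a : A) :
    M.bellman π Z s a =
      affineLaw (M.reward s a : Measure ℝ) M.discount (mixedLaw (M.trans s a : Measure S) π Z) :=
  rfl

theorem partialReturnLaw_succ (j : ℕ) :
    M.partialReturnLaw π (j + 1) = M.bellman π (M.partialReturnLaw π j) :=
  Function.iterate_succ_apply' _ _ _

theorem lintegral_nextLaw (s : S) (a : A) {f : S × A × ℝ → ℝ≥0∞} (hf : Measurable f) :
    ∫⁻ v, f v ∂(M.nextLaw π s a) = ∑ s', ∑ a', (M.trans s a : Measure S) {s'} *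
      (π s' : Measure A) {a'} * ∫⁻ r, f (s', a', r) ∂(M.reward s' a' : Measure ℝ) := by
  simp only [nextLaw, lintegral_finsetSum_measure, lintegral_smul_measure, smul_eq_mul, tripleLaw]
  refine Finset.sum_congr rfl fun s' _ => Finset.sum_congr rfl fun a' _ => ?_
  rw [lintegral_map hf (by fun_prop)]

theorem ae_nextLaw_mem (s : S) (a : A) :
    ∀ᵐ v ∂(M.nextLaw π s a), v.2.2 ∈ Icc M.rmin M.rmax := by
  have hs : MeasurableSet {v : S × A × ℝ | v.2.2 ∈ Icc M.rmin M.rmax} :=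
    measurableSet_Icc.preimage (by fun_prop)
  have : ∀ s' a', M.tripleLaw s' a' {v : S × A × ℝ | v.2.2 ∈ Icc M.rmin M.rmax}ᶜ = 0 :=
    fun s' a' => by
    rw [tripleLaw, Measure.map_apply (by fun_prop) hs.compl]
    exact M.reward_mem s' a'
  change M.nextLaw π s a {v : S × A × ℝ | v.2.2 ∈ Icc M.rmin M.rmax}ᶜ = 0
  simp only [nextLaw, Measure.finsetSum_apply, Measure.smul_apply, this, smul_zero,
    Finset.sum_const_zero]

variable [MeasurableSingletonClass S] [MeasurableSingletonClass A]

instance (s : S) (a : A) :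
    IsProbabilityMeasure (M.trajectoryLaw π s a) := by
  unfold trajectoryLaw
  infer_instance

theorem isProbabilityMeasure_bellman {Z : S → A → Measure ℝ}
    (hZ : ∀ s a, IsProbabilityMeasure (Z s a)) (s : S) (a : A) :
    IsProbabilityMeasure (M.bellman π Z s a) := by
  have := isProbabilityMeasure_mixedLaw (M.trans s a : Measure S) π hZ
  rw [bellman_apply]
  infer_instance

theorem isProbabilityMeasure_partialReturnLaw (j : ℕ) :
    ∀ s a, IsProbabilityMeasure (M.partialReturnLaw π j s a) := by
  induction j with
  | zero => exact fun _ _ => Measure.dirac.isProbabilityMeasure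
  | succ j ih =>
    intro s a
    rw [partialReturnLaw_succ]
    exact M.isProbabilityMeasure_bellman π ih s a

theorem map_trajectoryLaw_zero (s : S) (a : A) :
    (M.trajectoryLaw π s a).map (fun x => x 0) = M.tripleLaw s a := by
  have h : (fun x : ℕ → S × A × ℝ => x 0) =
      (fun y : (i : Finset.Iic 0) → S × A × ℝ => y ⟨0, Finset.mem_Iic.2 le_rfl⟩) ∘
        Preorder.frestrictLe 0 := rfl
  rw [h, ← Measure.map_map (by fun_prop) (by fun_prop), trajectoryLaw, Kernel.trajMeasure,
    Measure.map_comp _ _ (by fun_prop), Kernel.traj_map_frestrictLe, Kernel.partialTraj_self,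
    Measure.id_comp, Measure.map_map (by fun_prop) (by fun_prop)]
  exact Measure.map_id

/-- The Markov property at time `k`, in the only form needed: the past enters through the discounted
sum so far and the current triple. It follows from the description of the law of the first `k + 2`
triples as a composition product. -/
theorem lintegral_trajectoryLaw_succ (s : S) (a : A) (k : ℕ) {G : ℝ × (S × A × ℝ) → ℝ≥0∞}
    (hG : Measurable G) :
    ∫⁻ x, G (M.partialReturn (k + 1) x, x (k + 1)) ∂(M.trajectoryLaw π s a) =
      ∫⁻ x, ∫⁻ v, G (M.partialReturn (k + 1) x, v) ∂(M.nextLaw π (x k).1 (x k).2.1)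
        ∂(M.trajectoryLaw π s a) := by
  let κ : (n : ℕ) → Kernel ((i : Finset.Iic n) → S × A × ℝ) (S × A × ℝ) :=
    fun n => (M.stepKernel π).comap (fun x => x ⟨n, Finset.mem_Iic.2 le_rfl⟩)
      (measurable_pi_apply _)
  have hmap := Kernel.map_frestrictLe_trajMeasure_compProd_eq_map_trajMeasure
    (X := fun _ : ℕ => S × A × ℝ) (μ₀ := M.tripleLaw s a) (κ := κ) (a := k)
  let acc : ((i : Finset.Iic k) → S × A × ℝ) → ℝ := fun h =>
    ∑ i : Finset.Iic k, M.discount ^ (i : ℕ) * (h i).2.2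
  have hacc : Measurable acc := by fun_prop
  have hval : ∀ x : ℕ → S × A × ℝ, acc (Preorder.frestrictLe k x) = M.partialReturn (k + 1) x :=
    fun x => by
      rw [partialReturn, Nat.range_succ_eq_Iic]
      exact Finset.sum_coe_sort (Finset.Iic k) fun t => M.discount ^ t * (x t).2.2
  have hF : Measurable fun p : ((i : Finset.Iic k) → S × A × ℝ) × (S × A × ℝ) =>
      G (acc p.1, p.2) := hG.comp ((hacc.comp measurable_fst).prodMk measurable_snd)
  have e := congrArg (fun m => ∫⁻ p, G (acc p.1, p.2) ∂m) hmap
  beta_reduce at e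
  rw [Measure.lintegral_compProd hF, lintegral_map hF (by fun_prop),
    lintegral_map (hF.lintegral_kernel_prod_right') (by fun_prop)] at e
  simp only [hval] at e
  exact e.symm

theorem lintegral_mixedLaw_bellman (Z : S → A → Measure ℝ)
    (hZ : ∀ s a, IsProbabilityMeasure (Z s a)) (s : S) (a : A) {f : ℝ → ℝ≥0∞}
    (hf : Measurable f) :
    ∫⁻ u, f u ∂(mixedLaw (M.trans s a : Measure S) π (M.bellman π Z)) =
      ∑ s', ∑ a', (M.trans s a : Measure S) {s'} * (π s' : Measure A) {a'} *
        ∫⁻ r, ∫⁻ z, f (r + M.discount * z) ∂(mixedLaw (M.trans s' a' : Measure S) π Z)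
          ∂(M.reward s' a' : Measure ℝ) := by
  rw [lintegral_mixedLaw]
  refine Finset.sum_congr rfl fun s' _ => Finset.sum_congr rfl fun a' _ => ?_
  have := isProbabilityMeasure_mixedLaw (M.trans s' a' : Measure S) π hZ
  rw [bellman_apply, lintegral_affineLaw _ _ _ hf]

/-- The mixture depends on `e` only through a point of the finite set `S × A`, so it is a kernel. -/
theorem measurable_lintegral_mixedLaw {E : Type*} [MeasurableSpace E] {Z : S → A → Measure ℝ}
    (hZ : ∀ s a, IsProbabilityMeasure (Z s a)) {p : E → S × A} (hp : Measurable p)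
    {f : E → ℝ → ℝ≥0∞} (hf : Measurable (Function.uncurry f)) :
    Measurable fun e => ∫⁻ z, f e z ∂(mixedLaw (M.trans (p e).1 (p e).2 : Measure S) π Z) := by
  let κ : Kernel E ℝ := Kernel.comap
    (Kernel.ofFunOfCountable fun q : S × A => mixedLaw (M.trans q.1 q.2 : Measure S) π Z) p hp
  have : IsMarkovKernel κ :=
    ⟨fun e => isProbabilityMeasure_mixedLaw (M.trans (p e).1 (p e).2 : Measure S) π hZ⟩
  exact Measurable.lintegral_kernel_prod_right (κ := κ) hf

/-- Given the first `k + 1` triples, the next `j` rewards contribute `γ ^ (k + 1) * z`, with `z`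
drawn from the mixture of the `j`-step laws. The induction on `j` keeps `k` free: the hypothesis is
used at `k + 1`, and integrating out triple `k + 1` reproduces one application of the Bellman
operator. No time shift of the trajectory law is involved. -/
theorem lintegral_partialReturn_add (s : S) (a : A) (j : ℕ) :
    ∀ (k : ℕ) {f : ℝ → ℝ≥0∞}, Measurable f →
      ∫⁻ x, f (M.partialReturn (k + 1 + j) x) ∂(M.trajectoryLaw π s a) =
        ∫⁻ x, ∫⁻ z, f (M.partialReturn (k + 1) x + M.discount ^ (k + 1) * z)
          ∂(mixedLaw (M.trans (x k).1 (x k).2.1 : Measure S) π (M.partialReturnLaw π j))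
          ∂(M.trajectoryLaw π s a) := by
  induction j with
  | zero =>
    intro k f hf
    refine lintegral_congr fun x => ?_
    change _ = ∫⁻ z, _ ∂(mixedLaw _ π fun _ _ => Measure.dirac 0)
    rw [mixedLaw_const, lintegral_dirac]
    simp
  | succ j ih =>
    intro k f hf
    have hY := M.isProbabilityMeasure_partialReturnLaw π j
    let G : ℝ × (S × A × ℝ) → ℝ≥0∞ := fun p =>
      ∫⁻ z, f (p.1 + M.discount ^ (k + 1) * (p.2.2.2 + M.discount * z))
        ∂(mixedLaw (M.trans p.2.1 p.2.2.1 : Measure S) π (M.partialReturnLaw π j))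
    have hG : Measurable G := M.measurable_lintegral_mixedLaw π hY
      (p := fun p : ℝ × (S × A × ℝ) => (p.2.1, p.2.2.1)) (by fun_prop)
      (f := fun p z => f (p.1 + M.discount ^ (k + 1) * (p.2.2.2 + M.discount * z)))
      (hf.comp (by fun_prop))
    calc _ = ∫⁻ x, f (M.partialReturn (k + 1 + 1 + j) x) ∂(M.trajectoryLaw π s a) := by
          rw [show k + 1 + (j + 1) = k + 1 + 1 + j by ring]
      _ = ∫⁻ x, G (M.partialReturn (k + 1) x, x (k + 1)) ∂(M.trajectoryLaw π s a) := by
          rw [ih (k + 1) hf]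
          refine lintegral_congr fun x => lintegral_congr fun z => ?_
          congr 1
          rw [partialReturn, Finset.sum_range_succ, ← partialReturn]
          ring
      _ = _ := by
          rw [M.lintegral_trajectoryLaw_succ π s a k hG]
          refine lintegral_congr fun x => ?_
          rw [M.lintegral_nextLaw π _ _ (f := fun v => G (M.partialReturn (k + 1) x, v))
            (hG.comp measurable_prodMk_left), partialReturnLaw_succ, M.lintegral_mixedLaw_bellman π _ hY _ _
            (f := fun z => f (M.partialReturn (k + 1) x + M.discount ^ (k + 1) * z))
            (hf.comp (by fun_prop))]

theorem map_partialReturn (s : S) (a : A) (j : ℕ) :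
    (M.trajectoryLaw π s a).map (M.partialReturn (j + 1)) = M.partialReturnLaw π (j + 1) s a := by
  have hY := M.isProbabilityMeasure_partialReturnLaw π j
  have := isProbabilityMeasure_mixedLaw (M.trans s a : Measure S) π hY
  refine Measure.ext_of_lintegral _ fun f hf => ?_
  have hm : Measurable fun v : S × A × ℝ => ∫⁻ z, f (v.2.2 + M.discount * z)
      ∂(mixedLaw (M.trans v.1 v.2.1 : Measure S) π (M.partialReturnLaw π j)) :=
    M.measurable_lintegral_mixedLaw π hY (p := fun v : S × A × ℝ => (v.1, v.2.1)) (by fun_prop)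
      (f := fun v z => f (v.2.2 + M.discount * z)) (hf.comp (by fun_prop))
  rw [lintegral_map hf (M.measurable_partialReturn _), show j + 1 = 0 + 1 + j by ring,
    M.lintegral_partialReturn_add π s a j 0 hf, show 0 + 1 + j = j + 1 by ring,
    partialReturnLaw_succ, bellman_apply, lintegral_affineLaw _ _ _ hf]
  calc _ = ∫⁻ x, (fun v : S × A × ℝ => ∫⁻ z, f (v.2.2 + M.discount * z)
      ∂(mixedLaw (M.trans v.1 v.2.1 : Measure S) π (M.partialReturnLaw π j))) (x 0)
        ∂(M.trajectoryLaw π s a) := by simp [partialReturn]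
    _ = _ := by
      rw [← lintegral_map hm (measurable_pi_apply 0), M.map_trajectoryLaw_zero, tripleLaw,
        lintegral_map hm (by fun_prop)]

/-- Whatever the current state and action, `nextLaw` gives no mass to rewards outside the interval,
so at positive times one application of the Markov property suffices. -/
theorem ae_trajectoryLaw_mem (s : S) (a : A) :
    ∀ᵐ x ∂(M.trajectoryLaw π s a), ∀ t, (x t).2.2 ∈ Icc M.rmin M.rmax := by
  have hs : MeasurableSet {v : S × A × ℝ | v.2.2 ∈ Icc M.rmin M.rmax} :=
    measurableSet_Icc.preimage (by fun_prop)
  refine ae_all_iff.2 fun t => ?_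
  cases t with
  | zero =>
    refine ae_of_ae_map (f := fun x : ℕ → S × A × ℝ => x 0)
      (p := fun v => v.2.2 ∈ Icc M.rmin M.rmax) (measurable_pi_apply 0).aemeasurable ?_
    rw [M.map_trajectoryLaw_zero, tripleLaw]
    exact (ae_map_iff (by fun_prop) hs).2 (M.reward_mem s a)
  | succ k =>
    have h := M.lintegral_trajectoryLaw_succ π s a k
      (G := fun p => {v : S × A × ℝ | v.2.2 ∈ Icc M.rmin M.rmax}ᶜ.indicator 1 p.2)
      ((measurable_one.indicator hs.compl).comp measurable_snd)
    have h0 : ∀ s' a', ∫⁻ v, {v : S × A × ℝ | v.2.2 ∈ Icc M.rmin M.rmax}ᶜ.indicator 1 v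
        ∂(M.nextLaw π s' a') = 0 := fun s' a' => by
      rw [lintegral_indicator_one hs.compl]
      exact M.ae_nextLaw_mem π s' a'
    simp only [h0, lintegral_zero] at h
    have hm : Measurable fun x : ℕ → S × A × ℝ =>
        {v : S × A × ℝ | v.2.2 ∈ Icc M.rmin M.rmax}ᶜ.indicator (1 : S × A × ℝ → ℝ≥0∞) (x (k + 1)) :=
      (measurable_one.indicator hs.compl).comp (measurable_pi_apply (k + 1))
    rw [lintegral_eq_zero_iff hm] at h
    filter_upwards [h] with x hx
    by_contra hc
    exact hc (by simpa using hx)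

theorem ae_tendsto_partialReturn (s : S) (a : A) :
    ∀ᵐ x ∂(M.trajectoryLaw π s a), Tendsto (fun k => M.partialReturn k x) atTop
      (𝓝 (∑' t : ℕ, M.discount ^ t * (x t).2.2)) := by
  filter_upwards [M.ae_trajectoryLaw_mem π s a] with x hx
  exact (M.summable_rewards hx).hasSum.tendsto_sum_nat

/-- The series is almost surely the limit of its partial sums. Without a.e. measurability the
pushforward defining `returnLaw` would be the zero measure by convention. -/
theorem aemeasurable_return (s : S) (a : A) :
    AEMeasurable (fun x : ℕ → S × A × ℝ => ∑' t : ℕ, M.discount ^ t * (x t).2.2)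
      (M.trajectoryLaw π s a) :=
  aemeasurable_of_tendsto_metrizable_ae atTop
    (fun k => (M.measurable_partialReturn k).aemeasurable) (M.ae_tendsto_partialReturn π s a)

instance (s : S) (a : A) : IsProbabilityMeasure (M.returnLaw π s a) :=
  Measure.isProbabilityMeasure_map (M.aemeasurable_return π s a)

theorem isLawOn_returnLaw (s : S) (a : A) : IsLawOn M.vmin M.vmax (M.returnLaw π s a) := by
  refine isLawOn_of_ae_mem ((ae_map_iff (p := fun z => z ∈ Icc M.vmin M.vmax)
    (M.aemeasurable_return π s a) measurableSet_Icc).2 ?_)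
  have hgeo := hasSum_geometric_of_lt_one M.discount_nonneg M.discount_lt_one
  filter_upwards [M.ae_trajectoryLaw_mem π s a] with x hx
  have hsum := (M.summable_rewards hx).hasSum
  have hpow : ∀ t, 0 ≤ M.discount ^ t := fun t => pow_nonneg M.discount_nonneg t
  constructor
  · rw [vmin, div_eq_inv_mul]
    exact hasSum_le (fun t => mul_le_mul_of_nonneg_left (hx t).1 (hpow t))
      (hgeo.mul_right M.rmin) hsum
  · rw [vmax, div_eq_inv_mul]
    exact hasSum_le (fun t => mul_le_mul_of_nonneg_left (hx t).2 (hpow t)) hsum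
      (hgeo.mul_right M.rmax)

theorem tendsto_integral_partialReturnLaw (s : S) (a : A) (f : BoundedContinuousFunction ℝ ℝ) :
    Tendsto (fun j => ∫ z, f z ∂(M.partialReturnLaw π (j + 1) s a)) atTop
      (𝓝 (∫ z, f z ∂(M.returnLaw π s a))) := by
  have hmap : ∀ j, ∫ z, f z ∂(M.partialReturnLaw π (j + 1) s a) =
      ∫ x, f (M.partialReturn (j + 1) x) ∂(M.trajectoryLaw π s a) := fun j => by
    rw [← M.map_partialReturn, integral_map (M.measurable_partialReturn _).aemeasurable
      f.continuous.aestronglyMeasurable]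
  simp only [hmap]
  rw [returnLaw, integral_map (M.aemeasurable_return π s a) f.continuous.aestronglyMeasurable]
  refine tendsto_integral_of_dominated_convergence (fun _ => ‖f‖)
    (fun j => (f.continuous.measurable.comp (M.measurable_partialReturn _)).aestronglyMeasurable)
    (integrable_const _) (fun j => .of_forall fun x => f.norm_coe_le_norm _) ?_
  filter_upwards [M.ae_tendsto_partialReturn π s a] with x hx
  exact (f.continuous.tendsto _).comp ((tendsto_add_atTop_iff_nat 1).2 hx)

theorem integral_bellman {Z : S → A → Measure ℝ} (hZ : ∀ s a, IsProbabilityMeasure (Z s a))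
    (s : S) (a : A) (f : BoundedContinuousFunction ℝ ℝ) :
    ∫ u, f u ∂(M.bellman π Z s a) = ∫ r, ∑ s', ∑ a', (M.trans s a : Measure S).real {s'} *
      (π s' : Measure A).real {a'} * ∫ z, f (r + M.discount * z) ∂(Z s' a')
        ∂(M.reward s a : Measure ℝ) := by
  have := isProbabilityMeasure_mixedLaw (M.trans s a : Measure S) π hZ
  have hb : ∀ {E : Type} [MeasurableSpace E] (P : Measure E) [IsProbabilityMeasure P] (g : E → ℝ),
      Measurable g → Integrable (fun e => f (g e)) P := fun P _ g hg =>
    Integrable.of_bound (f.continuous.measurable.comp hg).aestronglyMeasurable ‖f‖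
      (.of_forall fun e => f.norm_coe_le_norm _)
  rw [bellman_apply, affineLaw, integral_map (by fun_prop) f.continuous.aestronglyMeasurable,
    integral_prod _ (hb _ _ (by fun_prop))]
  refine integral_congr_ae (.of_forall fun r => ?_)
  exact integral_mixedLaw _ π fun s a => by
    have := hZ s a
    exact hb _ _ (by fun_prop)

/-- Both sides of `partialReturnLaw (j + 2) = bellman (partialReturnLaw (j + 1))` converge weakly:
the left one to the law of the return, the right one because the Bellman operator is weakly
continuous. For fixed `r` the function `z ↦ f (r + γ z)` is again bounded and continuous, and
dominated convergence handles the integral over `r`. -/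
theorem bellman_returnLaw : M.bellman π (M.returnLaw π) = M.returnLaw π := by
  ext1 s
  ext1 a
  have hY := M.isProbabilityMeasure_partialReturnLaw π
  have hprob := M.isProbabilityMeasure_bellman π (Z := M.returnLaw π)
    (fun _ _ => inferInstance) s a
  refine ext_of_forall_integral_eq_of_IsFiniteMeasure fun f => ?_
  refine tendsto_nhds_unique ?_
    ((tendsto_add_atTop_iff_nat 1).2 (M.tendsto_integral_partialReturnLaw π s a f))
  have hstep : ∀ j, M.partialReturnLaw π (j + 1 + 1) s a =
      M.bellman π (M.partialReturnLaw π (j + 1)) s a := fun j => by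
    rw [partialReturnLaw_succ]
  have hmeas : ∀ (Z : S → A → Measure ℝ), (∀ s a, IsProbabilityMeasure (Z s a)) →
      Measurable fun r => ∑ s', ∑ a', (M.trans s a : Measure S).real {s'} *
        (π s' : Measure A).real {a'} * ∫ z, f (r + M.discount * z) ∂(Z s' a') := by
    intro Z hZ
    refine Finset.measurable_sum _ fun s' _ => Finset.measurable_sum _ fun a' _ =>
      Measurable.const_mul ?_ _
    have := hZ s' a'
    have hc : Continuous fun p : ℝ × ℝ => f (p.1 + M.discount * p.2) :=
      f.continuous.comp (by fun_prop)
    exact (hc.stronglyMeasurable.integral_prod_right (ν := Z s' a')).measurable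
  simp only [hstep]
  simp only [M.integral_bellman π (hY _)]
  rw [M.integral_bellman π fun _ _ => inferInstance]
  refine tendsto_integral_of_dominated_convergence (fun _ => ‖f‖)
    (fun j => (hmeas _ (hY _)).aestronglyMeasurable) (integrable_const _)
    (fun j => .of_forall fun r => ?_) (.of_forall fun r => ?_)
  · have hw := sum_mixed_weights (M.trans s a : Measure S) π
    calc _ ≤ ∑ s', ∑ a', (M.trans s a : Measure S).real {s'} *
        (π s' : Measure A).real {a'} * ‖f‖ := by
          refine (norm_sum_le _ _).trans (Finset.sum_le_sum fun s' _ => ?_)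
          refine (norm_sum_le _ _).trans (Finset.sum_le_sum fun a' _ => ?_)
          have := hY (j + 1) s' a'
          rw [norm_mul, Real.norm_of_nonneg (mul_nonneg measureReal_nonneg measureReal_nonneg)]
          refine mul_le_mul_of_nonneg_left ?_ (mul_nonneg measureReal_nonneg measureReal_nonneg)
          refine (norm_integral_le_of_norm_le_const (C := ‖f‖)
            (.of_forall fun z => f.norm_coe_le_norm _)).trans ?_
          simp
      _ = ‖f‖ := by simp only [← Finset.sum_mul, hw, one_mul]
  · refine tendsto_finsetSum _ fun s' _ => tendsto_finsetSum _ fun a' _ =>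
      Tendsto.const_mul _ ?_
    exact M.tendsto_integral_partialReturnLaw π s' a'
      (f.compContinuous ⟨fun z => r + M.discount * z, by fun_prop⟩)

end RewardMDP

/-! ### The empirical Bellman operator on the law of the return -/

/-- A uniform error of the reward law is not amplified, for any fixed `ν`. Hence `ν` may itself be
built from the transition samples, however these depend on the reward samples. -/
theorem cdf_affineLaw_le_add {ρ ρ' ν : Measure ℝ} [IsProbabilityMeasure ρ]
    [IsProbabilityMeasure ρ'] [IsProbabilityMeasure ν] {γ ε : ℝ}
    (h : ∀ y, cdf ρ' y ≤ cdf ρ y + ε) (x : ℝ) :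
    cdf (affineLaw ρ' γ ν) x ≤ cdf (affineLaw ρ γ ν) x + ε := by
  rw [cdf_affineLaw', cdf_affineLaw']
  calc _ ≤ ∫ z, (cdf ρ (x - γ * z) + ε) ∂ν := integral_mono (integrable_cdf_comp γ x)
        ((integrable_cdf_comp γ x).add (integrable_const _)) fun z => h _
    _ = _ := by
        rw [integral_add (integrable_cdf_comp γ x) (integrable_const _)]
        simp

section OneStep

variable {S A : Type*} [Fintype A] [MeasurableSpace A]

/-- The distribution function of `r + γ z`, where `r ∼ ρ` is independent of `z ∼ Z s a` and
`a ∼ π s`. -/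
noncomputable def oneStepCDF (ρ : Measure ℝ) (γ : ℝ) (π : S → ProbabilityMeasure A)
    (Z : S → A → Measure ℝ) (s : S) (x : ℝ) : ℝ :=
  ∑ a, (π s : Measure A).real {a} * cdf (affineLaw ρ γ (Z s a)) x

variable (ρ : Measure ℝ) (γ : ℝ) (π : S → ProbabilityMeasure A) (Z : S → A → Measure ℝ)

theorem monotone_oneStepCDF (s : S) : Monotone (oneStepCDF ρ γ π Z s) := fun _ _ hxy =>
  Finset.sum_le_sum fun _ _ => mul_le_mul_of_nonneg_left (monotone_cdf _ hxy) measureReal_nonneg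

theorem oneStepCDF_nonneg (s : S) (x : ℝ) : 0 ≤ oneStepCDF ρ γ π Z s x :=
  Finset.sum_nonneg fun _ _ => mul_nonneg measureReal_nonneg (cdf_nonneg _ _)

theorem oneStepCDF_le_one [MeasurableSingletonClass A] (s : S) (x : ℝ) :
    oneStepCDF ρ γ π Z s x ≤ 1 := by
  calc oneStepCDF ρ γ π Z s x ≤ ∑ a, (π s : Measure A).real {a} * 1 :=
        Finset.sum_le_sum fun _ _ => mul_le_mul_of_nonneg_left (cdf_le_one _ _) measureReal_nonneg
    _ = 1 := by
        simp only [mul_one]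
        rw [sum_measureReal_singleton]
        simp

theorem continuousWithinAt_oneStepCDF (s : S) (x : ℝ) :
    ContinuousWithinAt (oneStepCDF ρ γ π Z s) (Ici x) x :=
  tendsto_finsetSum _ fun _ _ => ((cdf _).right_continuous x).const_mul _

/-- The expression is linear in `P`. For empirical `P` it is an empirical mean of functions that are
monotone in `x` with values in `[0, 1]`, which is what the concentration inequality covers. -/
theorem cdf_affineLaw_mixedLaw [Fintype S] [MeasurableSpace S] [MeasurableSingletonClass S]
    [MeasurableSingletonClass A] [IsProbabilityMeasure ρ] {Z : S → A → Measure ℝ}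
    (hZ : ∀ s a, IsProbabilityMeasure (Z s a)) (P : Measure S) [IsProbabilityMeasure P] (x : ℝ) :
    cdf (affineLaw ρ γ (mixedLaw P π Z)) x = ∫ s, oneStepCDF ρ γ π Z s x ∂P := by
  have := isProbabilityMeasure_mixedLaw P π hZ
  rw [cdf_affineLaw', integral_mixedLaw P π fun s a => by
    have := hZ s a
    exact integrable_cdf_comp γ x, integral_fintype Integrable.of_finite]
  refine Finset.sum_congr rfl fun s _ => ?_
  rw [oneStepCDF, smul_eq_mul, Finset.mul_sum]
  refine Finset.sum_congr rfl fun a _ => ?_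
  have := hZ s a
  rw [cdf_affineLaw', mul_assoc]

end OneStep

theorem cdf_eq_integral_ite (ρ : Measure ℝ) [IsProbabilityMeasure ρ] (x : ℝ) :
    cdf ρ x = ∫ r, (if r ≤ x then (1 : ℝ) else 0) ∂ρ := by
  rw [cdf_eq_real, ← integral_indicator_one measurableSet_Iic]
  congr 1

theorem continuousWithinAt_ite_le (r x : ℝ) :
    ContinuousWithinAt (fun y => if r ≤ y then (1 : ℝ) else 0) (Ici x) x := by
  by_cases h : r ≤ x
  · refine (continuousWithinAt_const (b := (1 : ℝ))).congr (fun y hy => ?_) (if_pos h)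
    exact if_pos (h.trans hy)
  · refine (continuousWithinAt_const (b := (0 : ℝ))).congr_of_eventuallyEq ?_ (if_neg h)
    filter_upwards [mem_nhdsWithin_of_mem_nhds (Iio_mem_nhds (not_le.1 h))] with y hy
    exact if_neg (not_le.2 hy)

/-- Origin of the constant `14`: with `m` the maximum in the hypothesis, `exp (-(c / 2)) ≤ m⁻⁷`. Six
of these powers absorb `64 = 2 ^ 6 ≤ m ^ 6`, and the seventh absorbs `K ≤ m * δ`. -/
theorem card_mul_exp_neg_le {K δ c : ℝ} (hδ : 0 < δ)
    (hc : 14 * Real.log (max 2 (K / δ)) ≤ c) : K * (64 * Real.exp (-(c / 2))) ≤ δ := by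
  set m := max 2 (K / δ)
  have hm2 : 2 ≤ m := le_max_left _ _
  have hm0 : 0 < m := by linarith
  have hKm : K ≤ m * δ := (div_le_iff₀ hδ).1 (le_max_right _ _)
  have he : Real.exp (-(c / 2)) ≤ (m ^ 7)⁻¹ := by
    calc Real.exp (-(c / 2)) ≤ Real.exp (-((7 : ℕ) * Real.log m)) :=
          Real.exp_le_exp.2 (by push_cast; linarith)
      _ = (m ^ 7)⁻¹ := by rw [Real.exp_neg, Real.exp_nat_mul, Real.exp_log hm0]
  have h64 : (64 : ℝ) ≤ m ^ 6 := by
    calc (64 : ℝ) = 2 ^ 6 := by norm_num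
      _ ≤ m ^ 6 := pow_le_pow_left₀ (by norm_num) hm2 6
  calc K * (64 * Real.exp (-(c / 2))) ≤ (m * δ) * (m ^ 6 * (m ^ 7)⁻¹) := by
        refine mul_le_mul hKm ?_ (by positivity) (by positivity)
        exact mul_le_mul h64 he (Real.exp_pos _).le (by positivity)
    _ = δ := by field_simp

/-! ### The optimistic empirical Bellman operator for given samples -/

namespace RewardMDP

variable {S A : Type*} [MeasurableSpace S]

theorem vmin_eq (M : RewardMDP S A) : M.vmin = M.rmin + M.discount * M.vmin := by
  have : 1 - M.discount ≠ 0 := (sub_pos.2 M.discount_lt_one).ne'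
  rw [vmin]
  field_simp
  ring

theorem vmax_eq (M : RewardMDP S A) : M.vmax = M.rmax + M.discount * M.vmax := by
  have : 1 - M.discount ≠ 0 := (sub_pos.2 M.discount_lt_one).ne'
  rw [vmax]
  field_simp
  ring

variable [Fintype S] [Fintype A] [MeasurableSpace A]
  [MeasurableSingletonClass S] [MeasurableSingletonClass A]
  (M : RewardMDP S A) (π : S → ProbabilityMeasure A) {n : S → A → ℕ}

/-- The optimistic empirical Bellman operator for given samples. -/
noncomputable def optimisticBellman (n : S → A → ℕ) (c : ℝ≥0)
    (r : (s : S) → (a : A) → Fin (n s a) → ℝ) (p : (s : S) → (a : A) → Fin (n s a) → S) :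
    (S → A → Measure ℝ) → (S → A → Measure ℝ) := fun Z =>
  optimism M.vmax n c (distBellman (fun s a => empiricalMeasure (r s a))
    (fun s a => empiricalMeasure (p s a)) π M.discount Z)

variable {M π} (hn : ∀ s a, 0 < n s a) {c : ℝ≥0} {r : (s : S) → (a : A) → Fin (n s a) → ℝ}
  {p : (s : S) → (a : A) → Fin (n s a) → S} (hr : ∀ s a i, r s a i ∈ Icc M.rmin M.rmax)

include hn hr

theorem isLawOn_distBellman_empirical (Z : S → A → Measure ℝ)
    (hZ : ∀ s a, IsLawOn M.vmin M.vmax (Z s a)) (s : S) (a : A) :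
    IsLawOn M.vmin M.vmax (distBellman (fun s a => empiricalMeasure (r s a))
      (fun s a => empiricalMeasure (p s a)) π M.discount Z s a) := by
  have hp := fun s a => isProbabilityMeasure_empiricalMeasure (hn s a) (p s a)
  refine isLawOn_distBellman π M.discount_nonneg M.vmin_eq M.vmax_eq (fun s a => ?_) hp hZ s a
  have := isProbabilityMeasure_empiricalMeasure (hn s a) (r s a)
  exact isLawOn_of_ae_mem (ae_mem_empiricalMeasure measurableSet_Icc (hr s a))

theorem isLawOn_optimisticBellman (Z : S → A → Measure ℝ)
    (hZ : ∀ s a, IsLawOn M.vmin M.vmax (Z s a)) (s : S) (a : A) :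
    IsLawOn M.vmin M.vmax (M.optimisticBellman π n c r p Z s a) :=
  isLawOn_optimisticLaw (isLawOn_distBellman_empirical hn hr Z hZ s a) _

theorem cdf_optimisticBellman_mono (Z Z' : S → A → Measure ℝ)
    (hZ : ∀ s a, IsLawOn M.vmin M.vmax (Z s a)) (hZ' : ∀ s a, IsLawOn M.vmin M.vmax (Z' s a))
    (hle : ∀ s a x, cdf (Z s a) x ≤ cdf (Z' s a) x) (s : S) (a : A) (x : ℝ) :
    cdf (M.optimisticBellman π n c r p Z s a) x ≤
      cdf (M.optimisticBellman π n c r p Z' s a) x :=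
  cdf_optimisticLaw_mono (isLawOn_distBellman_empirical hn hr Z hZ s a)
    (isLawOn_distBellman_empirical hn hr Z' hZ' s a) _
    (cdf_distBellman_mono π M.discount_nonneg
      (fun s a => isProbabilityMeasure_empiricalMeasure (hn s a) (r s a))
      (fun s a => isProbabilityMeasure_empiricalMeasure (hn s a) (p s a))
      (fun s a => (hZ s a).1) (fun s a => (hZ' s a).1) hle s a) x

theorem cdfDist_optimisticBellman_le (Z Z' : S → A → Measure ℝ) (d : ℝ)
    (hZ : ∀ s a, IsLawOn M.vmin M.vmax (Z s a)) (hZ' : ∀ s a, IsLawOn M.vmin M.vmax (Z' s a))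
    (hd : ∀ s a, cdfDist (Z s a) (Z' s a) ≤ d) (s : S) (a : A) :
    cdfDist (M.optimisticBellman π n c r p Z s a) (M.optimisticBellman π n c r p Z' s a) ≤
      M.discount * d :=
  (cdfDist_optimisticLaw_le (isLawOn_distBellman_empirical hn hr Z hZ s a)
    (isLawOn_distBellman_empirical hn hr Z' hZ' s a) _).trans
    (cdfDist_distBellman_le hn r π M.discount_nonneg
      (fun s a => isProbabilityMeasure_empiricalMeasure (hn s a) (p s a)) hZ hZ' hd s a)

/-- Optimism: if the empirical distributions are uniformly close to the true ones, then the
optimistic empirical Bellman operator increases the law of the return stochastically. -/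
theorem cdf_optimisticBellman_returnLaw_le
    (hrew : ∀ s a x, (n s a : ℝ)⁻¹ * ∑ i, (if r s a i ≤ x then (1 : ℝ) else 0) ≤
      c / 2 / √(n s a) + ∫ y, (if y ≤ x then (1 : ℝ) else 0) ∂(M.reward s a : Measure ℝ))
    (hnxt : ∀ s a x, (n s a : ℝ)⁻¹ * ∑ i,
      oneStepCDF (M.reward s a : Measure ℝ) M.discount π (M.returnLaw π) (p s a i) x ≤
      c / 2 / √(n s a) + ∫ s', oneStepCDF (M.reward s a : Measure ℝ) M.discount π
        (M.returnLaw π) s' x ∂(M.trans s a : Measure S)) (s : S) (a : A) (x : ℝ) :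
    cdf (M.optimisticBellman π n c r p (M.returnLaw π) s a) x ≤ cdf (M.returnLaw π s a) x := by
  have hp := isProbabilityMeasure_empiricalMeasure (hn s a) (p s a)
  have hr' := isProbabilityMeasure_empiricalMeasure (hn s a) (r s a)
  have hZ : ∀ s a, IsProbabilityMeasure (M.returnLaw π s a) := fun _ _ => inferInstance
  have hmix := isProbabilityMeasure_mixedLaw (empiricalMeasure (p s a)) π hZ
  refine cdf_optimisticLaw_le
    (isLawOn_distBellman_empirical hn hr _ (M.isLawOn_returnLaw π) s a)
    (M.isLawOn_returnLaw π s a) (fun x => ?_) x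
  -- The error is split into two halves of the shift. Here the reward law changes, with the
  -- empirical mixture of next states held fixed; in `h2` the transition law changes, with the true
  -- reward law and the true law of the return. The functions averaged in `h2` are thus
  -- deterministic.
  have h1 : ∀ y, cdf (empiricalMeasure (r s a)) y ≤
      cdf (M.reward s a : Measure ℝ) y + c / 2 / √(n s a) := fun y => by
    rw [cdf_eq_integral_ite, cdf_eq_integral_ite, integral_empiricalMeasure]
    linarith [hrew s a y]
  have h2 : cdf (affineLaw (M.reward s a : Measure ℝ) M.discount
      (mixedLaw (empiricalMeasure (p s a)) π (M.returnLaw π))) x ≤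
      cdf (M.returnLaw π s a) x + c / 2 / √(n s a) := by
    conv_rhs => rw [← M.bellman_returnLaw π]
    rw [bellman_apply, cdf_affineLaw_mixedLaw _ _ π hZ, cdf_affineLaw_mixedLaw _ _ π hZ,
      integral_empiricalMeasure]
    linarith [hnxt s a x]
  have h3 := cdf_affineLaw_le_add (γ := M.discount)
    (ν := mixedLaw (empiricalMeasure (p s a)) π (M.returnLaw π)) h1 x
  have h4 : ((c / NNReal.sqrt (n s a) : ℝ≥0) : ℝ) = c / 2 / √(n s a) + c / 2 / √(n s a) := by
    push_cast
    ring
  rw [distBellman_apply, h4]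
  linarith

end RewardMDP

/-- Uniform closeness of the empirical reward and transition distributions to the true ones, and
validity of the reward samples, hold with high probability. -/
theorem RewardMDP.measure_exists_bad_sample_le {S A : Type*} [Fintype S] [Fintype A]
    [MeasurableSpace S] [MeasurableSingletonClass S] [MeasurableSpace A]
    [MeasurableSingletonClass A] (M : RewardMDP S A) (π : S → ProbabilityMeasure A)
    {n : S → A → ℕ} (hn : ∀ s a, 0 < n s a) {Ω : Type*} [MeasurableSpace Ω] {μ : Measure Ω}
    [IsProbabilityMeasure μ] {rew : (s : S) → (a : A) → Fin (n s a) → Ω → ℝ}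
    {nxt : (s : S) → (a : A) → Fin (n s a) → Ω → S}
    (hrew : ∀ s a i, HasLaw (rew s a i) (M.reward s a : Measure ℝ) μ)
    (hnxt : ∀ s a i, HasLaw (nxt s a i) (M.trans s a : Measure S) μ)
    (hrewi : ∀ s a, iIndepFun (rew s a) μ) (hnxti : ∀ s a, iIndepFun (nxt s a) μ) (t : ℝ) :
    μ {ω | ∃ s a, (∃ i, rew s a i ω ∉ Icc M.rmin M.rmax) ∨
      (∃ x, t / √(n s a) + ∫ y, (if y ≤ x then (1 : ℝ) else 0) ∂(M.reward s a : Measure ℝ) <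
        (n s a : ℝ)⁻¹ * ∑ i, (if rew s a i ω ≤ x then (1 : ℝ) else 0)) ∨
      (∃ x, t / √(n s a) + ∫ s', oneStepCDF (M.reward s a : Measure ℝ) M.discount π
        (M.returnLaw π) s' x ∂(M.trans s a : Measure S) <
        (n s a : ℝ)⁻¹ * ∑ i, oneStepCDF (M.reward s a : Measure ℝ) M.discount π (M.returnLaw π)
          (nxt s a i ω) x)} ≤
      ENNReal.ofReal (Fintype.card S * Fintype.card A * (64 * Real.exp (-t))) := by
  simp only [ofPred_exists, ofPred_or]
  have h1 : ∀ s a, μ (⋃ i, {ω | rew s a i ω ∉ Icc M.rmin M.rmax}) = 0 := fun s a => by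
    refine measure_iUnion_null fun i => ?_
    have := (hrew s a i).map_eq ▸ M.reward_mem s a
    exact ae_of_ae_map (hrew s a i).aemeasurable this
  have h2 := fun s a => measure_exists_deviation_le (n := n s a) (M.reward s a : Measure ℝ)
    (a := fun y x => if y ≤ x then (1 : ℝ) else 0)
    (fun x => Measurable.ite measurableSet_Iic measurable_const measurable_const)
    (fun y x x' hx => by
      by_cases h : y ≤ x
      · simp [h, h.trans hx]
      · simp only [if_neg h]; split_ifs <;> simp)
    (fun y x => by split_ifs <;> simp) (fun y x => by split_ifs <;> simp)
    continuousWithinAt_ite_le (hn s a) (hrew s a) (hrewi s a) t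
  have h3 := fun s a => measure_exists_deviation_le (n := n s a) (M.trans s a : Measure S)
    (a := oneStepCDF (M.reward s a : Measure ℝ) M.discount π (M.returnLaw π))
    (fun x => measurable_of_finite _) (monotone_oneStepCDF _ _ π _) (oneStepCDF_nonneg _ _ π _)
    (oneStepCDF_le_one _ _ π _) (continuousWithinAt_oneStepCDF _ _ π _) (hn s a) (hnxt s a)
    (hnxti s a) t
  simp only [ofPred_exists] at h2 h3
  -- Each pair pays once for its rewards and once for its transitions; rewards out of range have
  -- probability zero.
  have h4 : ENNReal.ofReal (32 * Real.exp (-t)) + ENNReal.ofReal (32 * Real.exp (-t)) =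
      ENNReal.ofReal (64 * Real.exp (-t)) := by
    rw [← ENNReal.ofReal_add (by positivity) (by positivity)]
    congr 1
    ring
  calc _ ≤ ∑ _s : S, ∑ _a : A, ENNReal.ofReal (64 * Real.exp (-t)) := by
        refine (measure_iUnion_fintype_le _ _).trans (Finset.sum_le_sum fun s _ => ?_)
        refine (measure_iUnion_fintype_le _ _).trans (Finset.sum_le_sum fun a _ => ?_)
        refine (measure_union_le _ _).trans ?_
        rw [h1 s a, zero_add, ← h4]
        exact (measure_union_le _ _).trans (add_le_add (h2 s a) (h3 s a))
    _ = _ := by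
        simp only [Finset.sum_const, Finset.card_univ, nsmul_eq_mul]
        rw [ENNReal.ofReal_mul (p := _ * _) (by positivity), ENNReal.ofReal_mul (Nat.cast_nonneg _),
          ENNReal.ofReal_natCast, ENNReal.ofReal_natCast, mul_assoc]

theorem mainTheorem2 :
    ∃ C : ℝ, 0 < C ∧
      ∀ (S A : Type*) [Fintype S] [Fintype A]
        [MeasurableSpace S] [MeasurableSingletonClass S]
        [MeasurableSpace A] [MeasurableSingletonClass A]
        (M : RewardMDP S A) (π : S → ProbabilityMeasure A)
        (n : S → A → ℕ) (_ : ∀ s a, 0 < n s a)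
        (Ω : Type*) [MeasurableSpace Ω] (μ : Measure Ω) [IsProbabilityMeasure μ]
        (rew : (s : S) → (a : A) → Fin (n s a) → Ω → ℝ)
        (nxt : (s : S) → (a : A) → Fin (n s a) → Ω → S)
        (_ : ∀ s a i, HasLaw (rew s a i) (M.reward s a : Measure ℝ) μ)
        (_ : ∀ s a i, HasLaw (nxt s a i) (M.trans s a : Measure S) μ)
        (_ : ∀ s a, iIndepFun (rew s a) μ)
        (_ : ∀ s a, iIndepFun (nxt s a) μ)
        (δ : ℝ) (_ : 0 < δ) (_ : δ < 1)
        (c : ℝ≥0)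
        (_ : C * Real.log (max 2 (Fintype.card S * Fintype.card A / δ)) ≤ c),
        ∃ E : Set Ω, MeasurableSet E ∧ ENNReal.ofReal (1 - δ) ≤ μ E ∧
          ∀ ω ∈ E,
            let U : (S → A → Measure ℝ) → (S → A → Measure ℝ) := fun Z =>
              optimism M.vmax n c
                (distBellman (fun s a => empiricalMeasure (fun i => rew s a i ω))
                  (fun s a => empiricalMeasure (fun i => nxt s a i ω)) π M.discount Z)
            ∃ Zlim ∈ M.valueDists,
              U Zlim = Zlim ∧
              (∀ Z ∈ M.valueDists, U Z = Z → Z = Zlim) ∧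
              (∀ Z₀ ∈ M.valueDists,
                (∀ m : ℕ, U^[m] Z₀ ∈ M.valueDists) ∧
                Tendsto (fun m : ℕ => cramerDist (U^[m] Z₀) Zlim) atTop (𝓝 0) ∧
                ∀ α : ℝ, 0 < α → α ≤ 1 → ∀ s a,
                  Tendsto (fun m : ℕ => cvar α ((U^[m] Z₀) s a)) atTop
                    (𝓝 (cvar α (Zlim s a)))) ∧
              ∀ α : ℝ, 0 < α → α ≤ 1 → ∀ s a,
                cvar α (M.returnLaw π s a) ≤ cvar α (Zlim s a) := by
  refine ⟨14, by norm_num, ?_⟩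
  intro S A _ _ _ _ _ _ M π n hn Ω _ μ _ rew nxt hrew hnxt hrewi hnxti δ hδ hδ1 c hc
  have hbad := M.measure_exists_bad_sample_le π hn hrew hnxt hrewi hnxti (c / 2)
  set B : Set Ω := {ω | ∃ s a, (∃ i, rew s a i ω ∉ Icc M.rmin M.rmax) ∨ _}
  -- The bad event is defined by uncountably many thresholds, so a measurable superset of the same
  -- measure is removed instead.
  refine ⟨(toMeasurable μ B)ᶜ, (measurableSet_toMeasurable μ B).compl, ?_, fun ω hω => ?_⟩
  · rw [prob_compl_eq_one_sub (measurableSet_toMeasurable μ B), measure_toMeasurable,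
      ENNReal.ofReal_sub _ hδ.le, ENNReal.ofReal_one]
    exact tsub_le_tsub_left (hbad.trans (ENNReal.ofReal_le_ofReal (card_mul_exp_neg_le hδ hc))) _
  have hgood : ω ∉ B := fun h => hω (subset_toMeasurable μ B h)
  simp only [B, mem_ofPred_eq, not_exists, not_or, not_not, not_lt] at hgood
  intro U
  have hr : ∀ s a i, rew s a i ω ∈ Icc M.rmin M.rmax := fun s a => (hgood s a).1
  have hU : ∀ Z, (∀ s a, IsLawOn M.vmin M.vmax (Z s a)) →
      ∀ s a, IsLawOn M.vmin M.vmax (U Z s a) := RewardMDP.isLawOn_optimisticBellman hn hr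
  have hmono : ∀ Z Z', (∀ s a, IsLawOn M.vmin M.vmax (Z s a)) →
      (∀ s a, IsLawOn M.vmin M.vmax (Z' s a)) → (∀ s a x, cdf (Z s a) x ≤ cdf (Z' s a) x) →
      ∀ s a x, cdf (U Z s a) x ≤ cdf (U Z' s a) x := RewardMDP.cdf_optimisticBellman_mono hn hr
  have hcontr : ∀ Z Z' d, (∀ s a, IsLawOn M.vmin M.vmax (Z s a)) →
      (∀ s a, IsLawOn M.vmin M.vmax (Z' s a)) → (∀ s a, cdfDist (Z s a) (Z' s a) ≤ d) →
      ∀ s a, cdfDist (U Z s a) (U Z' s a) ≤ M.discount * d :=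
    RewardMDP.cdfDist_optimisticBellman_le hn hr
  have hle : ∀ s a x, cdf (U (M.returnLaw π) s a) x ≤ cdf (M.returnLaw π s a) x :=
    RewardMDP.cdf_optimisticBellman_returnLaw_le hn hr (fun s a => (hgood s a).2.1)
      fun s a => (hgood s a).2.2
  have hπ := M.isLawOn_returnLaw π
  obtain ⟨Zlim, hZlim, hfix⟩ := exists_fixedPoint (fun s a => (hπ s a).le) hU hmono hcontr
  have hlim : ∀ Z, (∀ s a, IsLawOn M.vmin M.vmax (Z s a)) → ∀ s a,
      Tendsto (fun m => cdfDist (U^[m] Z s a) (Zlim s a)) atTop (𝓝 0) := fun Z hZ =>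
    tendsto_cdfDist_iterate M.discount_nonneg M.discount_lt_one hU hcontr hZ hZlim hfix
  refine ⟨Zlim, hZlim, hfix, fun Z hZ hZfix => fixedPoint_unique M.discount_nonneg
    M.discount_lt_one hU hcontr hZ hZlim hZfix hfix, fun Z hZ => ⟨isLawOn_iterate hU hZ,
    tendsto_cramerDist (isLawOn_iterate hU hZ) hZlim (hlim Z hZ), fun α hα hα1 s a =>
    tendsto_cvar (fun m => isLawOn_iterate hU hZ m s a) (hZlim s a) (hlim Z hZ s a) hα hα1⟩,
    fun α hα hα1 s a => ?_⟩
  -- The fixed point is approached from the law of the return. By `hle` and monotonicity the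
  -- distribution functions decrease along these iterates, so every CVaR is at least the initial
  -- one, and the bound passes to the limit.
  have hiter := fun m => isLawOn_iterate hU hπ m
  refine ge_of_tendsto' (tendsto_cvar (fun m => hiter m s a) (hZlim s a) (hlim _ hπ s a) hα hα1)
    fun m => (hiter m s a).cvar_mono (hπ s a) (fun x => ?_) hα hα1
  exact antitone_nat_of_succ_le (f := fun m => cdf (U^[m] (M.returnLaw π) s a) x)
    (fun m => cdf_iterate_le hU hmono hπ hle m s a x) (Nat.zero_le m)
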